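/- Let $G$ be a finite $(c,d)$-regular bipartite graph (simple; its vertex set splits into two parts, every edge joins the two parts, the vertices of one part have degree $c$, those of the other degree $d$), of girth $g$. Let $i$ and $k$ be integers with $k\ge 1$ and $i+2k<2g$ (that is, $1\le k<g-\frac i2$). Let $N_i$ be the number of cycles of length $i$ in $G$ (as subgraphs), and let $\Lambda(i,2k)$ be the set of closed walks $w_0,w_1,\dots,w_{i+2k}=w_0$ in $G$ that are not themselves cycles, whose edges contain a cycle of length $i$, and whose initial vertex $w_0$ does not lie on that cycle. (A walk carries its initial vertex and its direction.) Let $\mathscr C=v_0v_1\cdots v_{i-1}v_0$ be a cycle of length $i$ in $G$ with $\deg v_0=c$, directed by $v_0\to v_1\to\cdots$. For a vertex $v$ of $\mathscr C$ and $1\le l\le k$, let $\mathfrak W(v,l)$ be the set of closed walks of length $i+2k$, not themselves cycles, that contain all edges of $\mathscr C$, run round $\mathscr C$ in its direction (they make more steps along edges of $\mathscr C$ in the direction of $\mathscr C$ than against it), start at a vertex $z\notin\mathscr C$ with $d(z,v)=l$, and for which $v$ is the first vertex of $\mathscr C$ that appears in the walk. Let $N_l(v)$ be the set of initial vertices of the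 walks in $\mathfrak W(v,l)$, and for $z\in N_l(v)$ let $\Lambda^{z}_{v}(l)$ be the set of walks in $\mathfrak W(v,l)$ with initial vertex $z$. Then $$|\Lambda(i,2k)|= i\,N_i\sum_{l=1}^{k}\bigl(|\mathfrak W(v_0,l)|+|\mathfrak W(v_1,l)|\bigr).$$ Moreover, for $1\le l\le k$ and $v\in\{v_0,v_1\}$, $$|\mathfrak W(v,l)|=|N_l(v)|\,|\Lambda^{z}_{v}(l)|\quad\text{for every } z\in N_l(v),$$ and $$|N_l(v_0)|=(c-2)(d-1)^{\lceil\frac{l-1}{2}\rceil}(c-1)^{\lfloor\frac{l-1}{2}\rfloor},\qquad |N_l(v_1)|=(d-2)(c-1)^{\lceil\frac{l-1}{2}\rceil}(d-1)^{\lfloor\frac{l-1}{2}\rfloor}.$$ If $G$ has no cycle of length $i$, then $|\Lambda(i,2k)|=0$. -/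

import Mathlib

namespace CycleWalks

/-- A `(c, d)`-regular bipartite graph: the vertex set splits into two parts, every edge joins
the two parts, the vertices of the first part have degree `c` and those of the second `d`. -/
def IsBiregularBipartite {V : Type*} [Fintype V] (G : SimpleGraph V) [DecidableRel G.Adj]
    (c d : ℕ) : Prop :=
  ∃ A B : Set V, IsCompl A B ∧ G.IsBipartiteWith A B ∧
    (∀ x ∈ A, G.degree x = c) ∧ (∀ x ∈ B, G.degree x = d)

variable {V : Type*}

/-- The cycles of length `i` of `G`, as subgraphs (no base point, no direction). -/
def cyclesOfLength (G : SimpleGraph V) (i : ℕ) : Set G.Subgraph :=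
  {H | ∃ (u : V) (q : G.Walk u u), q.IsCycle ∧ q.length = i ∧ q.toSubgraph = H}

/-- `N_i`, the number of cycles of length `i`. -/
noncomputable def numCycles (G : SimpleGraph V) (i : ℕ) : ℕ := (cyclesOfLength G i).ncard

/-- `Λ(i, 2k)`: the closed walks of length `i + 2k` (together with their initial vertex) that are
not themselves cycles, whose edges contain a cycle of length `i`, and whose initial vertex is not
on that cycle. -/
def closedWalksOff (G : SimpleGraph V) (i k : ℕ) : Set (Σ u : V, G.Walk u u) :=
  {w | w.2.length = i + 2 * k ∧ ¬ w.2.IsCycle ∧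
    ∃ H ∈ cyclesOfLength G i, H ≤ w.2.toSubgraph ∧ w.1 ∉ H.verts}

open Classical in
/-- The walk `p` runs round the directed cycle `C` in the direction of `C`: it makes more steps
along the edges of `C` in the direction of `C` than in the opposite direction. -/
def HasDirection {G : SimpleGraph V} {a u v : V} (C : G.Walk a a) (p : G.Walk u v) : Prop :=
  p.darts.countP (fun e => decide (e.symm ∈ C.darts)) <
    p.darts.countP (fun e => decide (e ∈ C.darts))

/-- `v` is a vertex of `C`, and it is the first vertex of `C` that appears in the walk `p`. -/
def IsFirstHit {G : SimpleGraph V} {a u w : V} (C : G.Walk a a) (p : G.Walk u w) (v : V) : Prop :=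
  v ∈ C.support ∧ ∃ n ≤ p.length, p.getVert n = v ∧ ∀ m < n, p.getVert m ∉ C.support

/-- `𝔚(v, l)`, for a directed cycle `C`, a vertex `v` of `C` and walks of length `C.length + 2k`:
the closed walks of that length that are not cycles, contain the edges of `C`, run round `C` in
its direction, start off `C` at distance `l` from `v`, and meet `C` for the first time in `v`. -/
def walksVia {G : SimpleGraph V} {a : V} (C : G.Walk a a) (k : ℕ) (v : V) (l : ℕ) :
    Set (Σ u : V, G.Walk u u) :=
  {w | w.2.length = C.length + 2 * k ∧ ¬ w.2.IsCycle ∧ C.toSubgraph ≤ w.2.toSubgraph ∧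
    HasDirection C w.2 ∧ w.1 ∉ C.support ∧ G.dist w.1 v = l ∧ IsFirstHit C w.2 v}

/-- `N_l(v)`: the set of initial vertices of the walks in `𝔚(v, l)`. -/
def initialVertices {G : SimpleGraph V} {a : V} (C : G.Walk a a) (k : ℕ) (v : V) (l : ℕ) : Set V :=
  Sigma.fst '' walksVia C k v l

/-- `Λ^z_v(l)`: the walks in `𝔚(v, l)` with initial vertex `z`. -/
def walksViaFrom {G : SimpleGraph V} {a : V} (C : G.Walk a a) (k : ℕ) (v : V) (l : ℕ) (z : V) :
    Set (Σ u : V, G.Walk u u) :=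
  {w | w ∈ walksVia C k v l ∧ w.1 = z}

end CycleWalks

/-! Write g for the girth. Cancelling backtrackings brings every walk to a reduced form, and the
count sorts closed walks by that form.

The edges which a closed walk w uses an odd number of times form an even edge set F. Let D be a
nonempty even set of edges of w with D ≠ F. Nonempty even sets contain cycles, so D and D ∆ F have
at least g elements each, while w has length at least |F| + 2|D \ F| = |D| + |D ∆ F|. If w is
shorter than 2g, this is impossible. Hence a cycle C contained in w is unique, with edge set F
(`IsEvenEdgeSet.eq_oddEdges`).

A nonempty closed reduced walk shorter than 2g is a lollipop: a tail q, a cycle, and q backwards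
(`IsReduced.exists_lollipop`). Reduction preserves F and the signed number of steps along C. So the
reduced form of w goes once round C in the direction of w, from the vertex where w first meets C
(`isFirstHit_of_reduce_eq`). As g ≤ i, also 2k < g, which makes q the unique shortest path to that
vertex. Membership in 𝔚(v, l) therefore only prescribes the length of w and the shape of its reduced
form, with |q| = l (`mem_walksVia_iff`).

The number of walks of given length and reduced form depends only on the length of the form and the
degree of the start (`card_walks_reduce_eq`), hence not on z. Within distance l the graph branches
like a tree: a tail leaves v along one of deg v - 2 edges and then has one edge fewer than the
degree to choose from at each vertex; this counts N_l(v). Thus |𝔚(v, l)| depends only on deg v. Two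
directions and i/2 vertices of each degree on a cycle give the factor i. -/

namespace CycleWalks

open SimpleGraph

variable {V : Type*} {G : SimpleGraph V}

/-! ### Reduced walks and the girth -/

/-- A walk is reduced (non-backtracking) if no two consecutive edges coincide. -/
def IsReduced {u v : V} (p : G.Walk u v) : Prop := p.edges.IsChain (· ≠ ·)

lemma isReduced_nil (u : V) : IsReduced (Walk.nil : G.Walk u u) := by simp [IsReduced]

lemma isReduced_singleton {u v : V} (h : G.Adj u v) : IsReduced (Walk.cons h Walk.nil) := by
  simp [IsReduced]

lemma isReduced_cons_cons {u v x y : V} (h : G.Adj u v) (h' : G.Adj v x) (p : G.Walk x y) :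
    IsReduced (Walk.cons h (Walk.cons h' p)) ↔ x ≠ u ∧ IsReduced (Walk.cons h' p) := by
  simp only [IsReduced, Walk.edges_cons, List.isChain_cons_cons]
  refine and_congr_left fun _ => not_congr ?_
  rw [Sym2.eq_iff]
  constructor
  · rintro (⟨h1, -⟩ | ⟨h1, -⟩)
    · exact absurd h1 h.ne
    · exact h1.symm
  · rintro rfl
    exact Or.inr ⟨rfl, rfl⟩

lemma IsReduced.of_cons {u v y : V} {h : G.Adj u v} {p : G.Walk v y}
    (hp : IsReduced (Walk.cons h p)) : IsReduced p := by
  unfold IsReduced at *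
  rw [Walk.edges_cons] at hp
  exact hp.tail

lemma isReduced_append {u v w : V} (p : G.Walk u v) (q : G.Walk v w) :
    IsReduced (p.append q) ↔ IsReduced p ∧ IsReduced q ∧
      ∀ x ∈ p.edges.getLast?, ∀ y ∈ q.edges.head?, x ≠ y := by
  simp only [IsReduced, Walk.edges_append, List.isChain_append]

lemma IsReduced.of_append_left {u v w : V} {p : G.Walk u v} {q : G.Walk v w}
    (h : IsReduced (p.append q)) : IsReduced p := ((isReduced_append p q).1 h).1

lemma IsReduced.of_append_right {u v w : V} {p : G.Walk u v} {q : G.Walk v w}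
    (h : IsReduced (p.append q)) : IsReduced q := ((isReduced_append p q).1 h).2.1

lemma isReduced_reverse {u v : V} (p : G.Walk u v) : IsReduced p.reverse ↔ IsReduced p := by
  simp only [IsReduced, Walk.edges_reverse, List.isChain_reverse, ne_comm]

lemma IsReduced.reverse {u v : V} {p : G.Walk u v} (h : IsReduced p) : IsReduced p.reverse :=
  (isReduced_reverse p).2 h

lemma _root_.SimpleGraph.Walk.IsTrail.isReduced {u v : V} {p : G.Walk u v} (h : p.IsTrail) :
    IsReduced p := List.Pairwise.isChain h.edges_nodup

/-- Two reduced walks whose junction is not a backtracking, glued along a nonempty middle. -/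
lemma IsReduced.append_append {u v w x : V} {p : G.Walk u v} {q : G.Walk v w} {r : G.Walk w x}
    (h₁ : IsReduced (p.append q)) (h₂ : IsReduced (q.append r)) (hq : ¬ q.Nil) :
    IsReduced (p.append (q.append r)) := by
  rw [isReduced_append] at h₁ ⊢
  refine ⟨h₁.1, h₂, fun a ha b hb => h₁.2.2 a ha b ?_⟩
  rw [Walk.edges_append, List.head?_append_of_ne_nil _ (by
    simpa [Walk.edges_eq_nil] using hq)] at hb
  exact hb

/-- A reduced walk that is not a path contains a cycle. -/
lemma IsReduced.exists_isCycle {u v : V} {p : G.Walk u v} (hp : IsReduced p) (hn : ¬ p.IsPath) :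
    ∃ (x : V) (c : G.Walk x x), c.IsCycle ∧ c.length ≤ p.length ∧ c.edges ⊆ p.edges := by
  classical
  induction p with
  | nil => exact absurd Walk.IsPath.nil hn
  | @cons u v w h p ih =>
    by_cases hpp : p.IsPath
    · have hu : u ∈ p.support := by
        by_contra hu
        exact hn ((Walk.cons_isPath_iff h p).2 ⟨hpp, hu⟩)
      refine ⟨u, Walk.cons h (p.takeUntil u hu), ?_, ?_, ?_⟩
      · rw [Walk.cons_isCycle_iff]
        -- The piece of `p` up to `u` is a path from `v`, so only its first edge contains `v`;
        -- reducedness keeps that edge distinct from the edge `u v`.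
        refine ⟨hpp.takeUntil hu, fun he => ?_⟩
        cases p with
        | nil => simp at hu; exact h.ne hu
        | @cons _ x _ h' p =>
          have hxu := ((isReduced_cons_cons h h' p).1 hp).1
          have hvu : v ≠ u := h.ne'
          rw [Walk.takeUntil_cons (by simpa [h.ne] using hu) hvu] at he
          rw [Walk.edges_cons, List.mem_cons] at he
          rcases he with he | he
          · rw [Sym2.eq_iff] at he
            rcases he with ⟨h1, -⟩ | ⟨h1, -⟩
            · exact h.ne h1
            · exact hxu h1.symm
          · have := Walk.snd_mem_support_of_mem_edges _ he
            have := Walk.support_takeUntil_subset_support _ _ this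
            exact ((Walk.cons_isPath_iff h' p).1 hpp).2 this
      · simp [Walk.length_takeUntil_le_length]
      · rw [Walk.edges_cons, Walk.edges_cons]
        exact List.cons_subset_cons _ (Walk.edges_takeUntil_subset_edges _ _)
    · obtain ⟨x, c, hc, hl, he⟩ := ih hp.of_cons hpp
      exact ⟨x, c, hc, by simp; omega, fun e h => by simp [he h]⟩

lemma IsReduced.isPath {u v : V} {p : G.Walk u v} (hp : IsReduced p) (hl : p.length < G.girth) :
    p.IsPath := by
  by_contra hn
  obtain ⟨x, c, hc, h, -⟩ := hp.exists_isCycle hn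
  have := girth_le_length hc
  omega

lemma IsReduced.girth_le_length {u : V} {p : G.Walk u u} (hp : IsReduced p) (hn : ¬ p.Nil) :
    G.girth ≤ p.length := by
  by_contra hl
  have := hp.isPath (by omega)
  exact hn (Walk.isPath_iff_nil.1 this)

/-- Reduced walks with the same end points and of total length less than the girth agree. -/
lemma IsReduced.eq_of_length_add_lt {u v : V} {p q : G.Walk u v} (hp : IsReduced p)
    (hq : IsReduced q) (hl : p.length + q.length < G.girth) : p = q := by
  by_contra hne
  obtain ⟨x, -, -, c, hc, h⟩ := Walk.IsPath.exists_isCycle_length_le_add_of_ne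
    (hp.isPath (by omega)) (hq.isPath (by omega)) hne
  have := SimpleGraph.girth_le_length hc
  omega

/-- A reduced closed walk shorter than twice the girth does not return to its base early. -/
lemma IsReduced.eq_nil_of_append {u : V} {p q : G.Walk u u} (h : IsReduced (p.append q))
    (hl : (p.append q).length < 2 * G.girth) : p.Nil ∨ q.Nil := by
  by_contra! hn
  have h1 := h.of_append_left.girth_le_length hn.1
  have h2 := h.of_append_right.girth_le_length hn.2
  rw [Walk.length_append] at hl
  omega

end CycleWalks

/-! ### Reduction of walks, and lollipops -/

namespace CycleWalks

open SimpleGraph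

variable {V : Type*} {G : SimpleGraph V}

open Classical in
/-- Put the edge `h` in front of a walk, cancelling it against an opposite first step. -/
noncomputable def prepend {u v w : V} (h : G.Adj u v) : G.Walk v w → G.Walk u w
  | .nil => .cons h .nil
  | .cons (v := x) h' p => if e : x = u then p.copy e rfl else .cons h (.cons h' p)

/-- The dichotomy, cancellation or plain extension, from which the properties of `prepend` and
`reduce` are derived. -/
lemma prepend_eq {u v w : V} (h : G.Adj u v) (p : G.Walk v w) :
    (∃ p' : G.Walk u w, p = .cons h.symm p' ∧ prepend h p = p') ∨
      (prepend h p = .cons h p ∧ (IsReduced p → IsReduced (.cons h p))) := by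
  cases p with
  | nil => exact Or.inr ⟨rfl, fun _ => isReduced_singleton h⟩
  | @cons _ x _ h' p =>
    by_cases e : x = u
    · subst e
      exact Or.inl ⟨p, rfl, by simp [prepend]⟩
    · exact Or.inr ⟨by simp [prepend, e], fun hp => (isReduced_cons_cons h h' p).2 ⟨e, hp⟩⟩

lemma prepend_cons_symm {u v w : V} (h : G.Adj u v) (p : G.Walk u w) :
    prepend h (.cons h.symm p) = p := by simp [prepend]

lemma prepend_of_isReduced {u v w : V} {h : G.Adj u v} {p : G.Walk v w}
    (hp : IsReduced (.cons h p)) : prepend h p = .cons h p := by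
  rcases prepend_eq h p with ⟨p', rfl, -⟩ | ⟨h', -⟩
  · exact absurd rfl ((isReduced_cons_cons _ _ _).1 hp).1
  · exact h'

lemma isReduced_prepend {u v w : V} (h : G.Adj u v) {p : G.Walk v w} (hp : IsReduced p) :
    IsReduced (prepend h p) := by
  rcases prepend_eq h p with ⟨p', rfl, h'⟩ | ⟨h', h''⟩
  · rw [h']; exact hp.of_cons
  · rw [h']; exact h'' hp

lemma prepend_symm_prepend {u v w : V} (h : G.Adj u v) {p : G.Walk v w} (hp : IsReduced p) :
    prepend h.symm (prepend h p) = p := by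
  rcases prepend_eq h p with ⟨p', rfl, h'⟩ | ⟨h', h''⟩
  · rw [h', prepend_of_isReduced hp]
  · rw [h', prepend_cons_symm h.symm]

/-- On reduced walks `prepend h` is invertible. Once the first step of a walk is fixed, prescribing
its reduced form thus prescribes the reduced form of the rest. -/
lemma prepend_eq_iff {u v w : V} (h : G.Adj u v) {p : G.Walk v w} {q : G.Walk u w}
    (hp : IsReduced p) (hq : IsReduced q) : prepend h p = q ↔ p = prepend h.symm q := by
  constructor
  · rintro rfl
    rw [prepend_symm_prepend h hp]
  · rintro rfl
    exact prepend_symm_prepend h.symm hq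

/-- The reduced form of a walk, obtained by cancelling all backtrackings. -/
noncomputable def reduce {u v : V} : G.Walk u v → G.Walk u v
  | .nil => .nil
  | .cons h p => prepend h (reduce p)

lemma isReduced_reduce {u v : V} (p : G.Walk u v) : IsReduced (reduce p) := by
  induction p with
  | nil => exact isReduced_nil _
  | cons h p ih => exact isReduced_prepend h ih

lemma reduce_of_isReduced {u v : V} {p : G.Walk u v} (hp : IsReduced p) : reduce p = p := by
  induction p with
  | nil => rfl
  | cons h p ih => rw [reduce, ih hp.of_cons, prepend_of_isReduced hp]

lemma edges_reduce_sublist {u v : V} (p : G.Walk u v) :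
    List.Sublist (reduce p).edges p.edges := by
  induction p with
  | nil => exact List.Sublist.refl _
  | cons h p ih =>
    rw [reduce]
    rcases prepend_eq h (reduce p) with ⟨p', h1, h'⟩ | ⟨h', -⟩
    · rw [h', Walk.edges_cons]
      rw [h1, Walk.edges_cons] at ih
      exact ((List.sublist_cons_self _ _).trans ih).cons _
    · rw [h', Walk.edges_cons, Walk.edges_cons]
      exact ih.cons_cons _

lemma length_reduce_le {u v : V} (p : G.Walk u v) : (reduce p).length ≤ p.length := by
  simpa using (edges_reduce_sublist p).length_le

/-- Each cancellation removes two copies of one edge. -/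
lemma odd_count_edges_reduce [DecidableEq V] {u v : V} (p : G.Walk u v) (e : Sym2 V) :
    Odd ((reduce p).edges.count e) ↔ Odd (p.edges.count e) := by
  induction p with
  | nil => exact Iff.rfl
  | @cons u v w h p ih =>
    rw [reduce]
    rcases prepend_eq h (reduce p) with ⟨p', h1, h'⟩ | ⟨h', -⟩
    · rw [h', Walk.edges_cons]
      rw [h1, Walk.edges_cons, Sym2.eq_swap] at ih
      simp only [List.count_cons] at ih ⊢
      split_ifs at ih ⊢ <;> grind
    · rw [h']
      simp only [Walk.edges_cons, List.count_cons]
      split_ifs <;> grind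

/-- Cancelling a backtracking removes a dart together with the opposite dart. -/
lemma countP_darts_reduce {u v : V} (S : G.Dart → Bool) (p : G.Walk u v) :
    (reduce p).darts.countP S + p.darts.countP (fun e => S e.symm) =
      p.darts.countP S + (reduce p).darts.countP (fun e => S e.symm) := by
  induction p with
  | nil => rfl
  | @cons u v w h p ih =>
    rw [reduce]
    rcases prepend_eq h (reduce p) with ⟨p', h1, h'⟩ | ⟨h', -⟩
    · rw [h', Walk.darts_cons]
      rw [h1, Walk.darts_cons] at ih
      have e1 : (⟨(v, u), h.symm⟩ : G.Dart) = (⟨(u, v), h⟩ : G.Dart).symm := rfl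
      rw [e1] at ih
      simp only [List.countP_cons, Dart.symm_symm] at ih ⊢
      omega
    · rw [h']
      simp only [Walk.darts_cons, List.countP_cons]
      omega

lemma exists_append_append_of_not_isPath {u v : V} {p : G.Walk u v} (hp : ¬ p.IsPath) :
    ∃ (x : V) (a : G.Walk u x) (l : G.Walk x x) (b : G.Walk x v),
      p = a.append (l.append b) ∧ ¬ l.Nil := by
  classical
  induction p with
  | nil => exact absurd Walk.IsPath.nil hp
  | @cons u v w h p ih =>
    by_cases hpp : p.IsPath
    · have hu : u ∈ p.support := by
        by_contra hu
        exact hp ((Walk.cons_isPath_iff h p).2 ⟨hpp, hu⟩)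
      exact ⟨u, .nil, .cons h (p.takeUntil u hu), p.dropUntil u hu, by simp, by simp⟩
    · obtain ⟨x, a, l, b, rfl, hl⟩ := ih hpp
      exact ⟨x, .cons h a, l, b, rfl, hl⟩

/-- A closed reduced walk shorter than twice the girth, whose first and last edge differ, is a
cycle. -/
lemma IsReduced.isCycle_of_ne {u v : V} {h : G.Adj u v} {q : G.Walk v u}
    (hp : IsReduced (Walk.cons h q)) (hq : IsReduced (q.append (Walk.cons h Walk.nil)))
    (hl : (Walk.cons h q).length < 2 * G.girth) : (Walk.cons h q).IsCycle := by
  have hg : 3 ≤ G.girth := by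
    -- The girth of an acyclic graph is 0 by convention, which `hl` excludes.
    apply three_le_girth
    intro hA
    rw [← girth_eq_zero] at hA
    omega
  have hlen := hp.girth_le_length (by simp)
  rw [Walk.isCycle_iff_isPath_tail_and_le_length]
  refine ⟨?_, by omega⟩
  suffices hq : q.IsPath by
    rw [Walk.tail_cons]
    exact (Walk.isPath_copy _ _ _).2 hq
  by_contra hn
  obtain ⟨x, a, l, b, rfl, hln⟩ := exists_append_append_of_not_isPath hn
  have h1 : IsReduced l := hp.of_cons.of_append_right.of_append_left
  -- Going round twice exhibits the part complementary to `l`, namely `b`, `h`, `a`, as a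
  -- consecutive piece. It and `l` are nonempty closed reduced walks, each of length at least the
  -- girth.
  have h2 : IsReduced ((a.append (l.append b)).append
      ((Walk.cons h Walk.nil).append (a.append (l.append b)))) :=
    hq.append_append (by simpa using hp) (by simp)
  have h3 : IsReduced (b.append (Walk.cons h a)) := by
    have e : (a.append (l.append b)).append
      ((Walk.cons h Walk.nil).append (a.append (l.append b))) =
        (a.append l).append ((b.append (Walk.cons h a)).append (l.append b)) := by
      simp [← Walk.append_assoc]
    rw [e] at h2
    exact h2.of_append_right.of_append_left
  have h4 := h1.girth_le_length hln
  have h5 := h3.girth_le_length (by simp [Walk.nil_append_iff])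
  simp only [Walk.length_cons, Walk.length_append] at h5 hl
  omega

/-- A closed reduced walk shorter than twice the girth is a cycle with a tail. -/
lemma IsReduced.exists_lollipop {u : V} {p : G.Walk u u} (hp : IsReduced p) (hn : ¬ p.Nil)
    (hl : p.length < 2 * G.girth) :
    ∃ (x : V) (q : G.Walk u x) (c : G.Walk x x),
      c.IsCycle ∧ p = q.append (c.append q.reverse) := by
  induction hm : p.length using Nat.strongRec generalizing u with
  | ind m ih =>
    cases p with
    | nil => simp at hn
    | @cons _ v _ h q =>
      have hqn : ¬ q.Nil := fun hqn => h.ne hqn.eq.symm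
      have hq : q.dropLast.concat (q.adj_penultimate hqn) = q := by simp
      generalize q.dropLast = q' at hq
      generalize hy : q.adj_penultimate hqn = h' at hq
      clear hy
      generalize q.penultimate = y at q' h' hq
      -- The first and last edges coincide exactly when `y = v`. In that case the edge joins the
      -- tail and the induction hypothesis applies to `q'`; otherwise the whole walk is a cycle.
      by_cases hyv : y = v
      · subst hyv
        subst hq
        rw [Walk.concat_eq_append] at *
        have hr : IsReduced q' := hp.of_cons.of_append_left
        have hnn : ¬ q'.Nil := by
          intro hnil
          have := hnil.eq_nil
          subst this
          simp [isReduced_cons_cons] at hp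
        simp only [Walk.length_cons, Walk.length_append] at hl hm
        obtain ⟨x, Q, c, hc, rfl⟩ := ih q'.length (by omega) hr hnn (by omega) rfl
        refine ⟨x, Walk.cons h Q, c, hc, ?_⟩
        simp [Walk.append_assoc]
      · refine ⟨u, .nil, _, hp.isCycle_of_ne ?_ hl, by simp⟩
        rw [isReduced_append]
        refine ⟨hp.of_cons, isReduced_singleton h, ?_⟩
        subst hq
        simp only [Walk.edges_concat, List.concat_eq_append, Walk.edges_cons, List.getLast?_concat, Option.mem_def,
          Option.some.injEq, List.head?_cons, Walk.edges_nil]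
        rintro _ rfl _ rfl
        rw [ne_eq, Sym2.eq_iff]
        rintro (⟨h1, -⟩ | ⟨h1, -⟩)
        · exact h'.ne h1
        · exact hyv h1

/-- In a closed reduced walk shorter than twice the girth, a tail meets its cycle only once. -/
lemma IsReduced.eq_of_mem_lollipop {u x y : V} {q : G.Walk u x} {c : G.Walk x x}
    (h : IsReduced (q.append (c.append q.reverse)))
    (hl : (q.append (c.append q.reverse)).length < 2 * G.girth)
    (hq : y ∈ q.support) (hc : y ∈ c.support) : y = x := by
  classical
  obtain ⟨t, d, rfl⟩ := Walk.mem_support_iff_exists_append.1 hq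
  obtain ⟨a, b, rfl⟩ := Walk.mem_support_iff_exists_append.1 hc
  -- Cutting tail and cycle at `y` leaves in the middle two consecutive closed walks based at `y`,
  -- each containing a copy of `d`. One of them must be empty, so `d` is.
  have e : (t.append d).append ((a.append b).append (t.append d).reverse) =
      t.append (((d.append a).append (b.append d.reverse)).append t.reverse) := by
    simp [Walk.append_assoc]
  rw [e] at h hl
  have h1 : IsReduced ((d.append a).append (b.append d.reverse)) :=
    h.of_append_right.of_append_left
  have h2 := h1.eq_nil_of_append (by simp only [Walk.length_append] at hl ⊢; omega)
  simp only [Walk.nil_append_iff, Walk.nil_reverse] at h2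
  rcases h2 with h2 | h2
  · exact h2.1.eq
  · exact h2.2.eq

end CycleWalks

/-! ### Even edge sets and edges used an odd number of times -/

namespace CycleWalks

open SimpleGraph

variable {V : Type*} [DecidableEq V] {G : SimpleGraph V}

/-- A set of edges is even if every vertex lies on an even number of its members. -/
def IsEvenEdgeSet (D : Finset (Sym2 V)) : Prop := ∀ x, Even (D.filter (x ∈ ·)).card

lemma IsEvenEdgeSet.symmDiff_isEvenEdgeSet {D F : Finset (Sym2 V)} (hD : IsEvenEdgeSet D)
    (hF : IsEvenEdgeSet F) : IsEvenEdgeSet (symmDiff D F) := by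
  intro x
  have h1 := hD x
  have h2 := hF x
  rw [symmDiff_def, Finset.sup_eq_union, Finset.filter_union,
    Finset.card_union_of_disjoint (Finset.disjoint_filter_filter disjoint_sdiff_sdiff)]
  have e1 := Finset.card_filter_add_card_filter_not (s := D.filter (x ∈ ·)) (· ∈ F)
  have e2 := Finset.card_filter_add_card_filter_not (s := F.filter (x ∈ ·)) (· ∈ D)
  have a1 : (D.filter (x ∈ ·)).filter (· ∉ F) = (D \ F).filter (x ∈ ·) := by
    ext; simp; tauto
  have a2 : (F.filter (x ∈ ·)).filter (· ∉ D) = (F \ D).filter (x ∈ ·) := by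
    ext; simp; tauto
  have a3 : (D.filter (x ∈ ·)).filter (· ∈ F) = (F.filter (x ∈ ·)).filter (· ∈ D) := by
    ext; simp; tauto
  rw [a1, a3] at e1
  rw [a2] at e2
  grind

/-- A vertex on one edge of `D` lies on a second one, so reduced walks inside `D` can be extended
indefinitely. Once too long to be a path, such a walk contains a cycle with edges in `D`. -/
lemma IsEvenEdgeSet.girth_le_card [Fintype V] {D : Finset (Sym2 V)} (hD : IsEvenEdgeSet D)
    (hG : ∀ e ∈ D, e ∈ G.edgeSet) (hne : D.Nonempty) : G.girth ≤ D.card := by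
  have key : ∀ m : ℕ, ∃ (u v w : V) (h : G.Adj u v) (q : G.Walk v w),
      IsReduced (Walk.cons h q) ∧ q.length = m ∧ ∀ e ∈ (Walk.cons h q).edges, e ∈ D := by
    intro m
    induction m with
    | zero =>
      obtain ⟨e, he⟩ := hne
      induction e with
      | _ u v =>
      have huv : G.Adj u v := hG _ he
      exact ⟨u, v, v, huv, .nil, isReduced_singleton _, rfl, fun e h => by
        rw [Walk.edges_cons, Walk.edges_nil, List.mem_singleton] at h
        rwa [h]⟩
    | succ m ih =>
      obtain ⟨u, v, w, h, q, hr, hm, he⟩ := ih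
      have hmem : s(u, v) ∈ D.filter (u ∈ ·) := by
        simpa using he s(u, v) (by simp)
      have hcard : 1 < (D.filter (u ∈ ·)).card := by
        have h1 := hD u
        have h2 := Finset.card_pos.2 ⟨_, hmem⟩
        grind
      obtain ⟨e, heD, hne'⟩ := Finset.exists_mem_ne hcard s(u, v)
      rw [Finset.mem_filter] at heD
      obtain ⟨heD, hue⟩ := heD
      obtain ⟨x, rfl⟩ := Sym2.mem_iff_exists.1 hue
      have hux : G.Adj u x := hG _ heD
      refine ⟨x, u, w, hux.symm, .cons h q, (isReduced_cons_cons _ _ _).2 ⟨?_, hr⟩, by simp [hm],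
        ?_⟩
      · rintro rfl
        exact hne' rfl
      · intro e' he'
        rw [Walk.edges_cons, List.mem_cons] at he'
        rcases he' with rfl | he'
        · rwa [Sym2.eq_swap]
        · exact he _ he'
  obtain ⟨u, v, w, h, q, hr, hm, he⟩ := key (Fintype.card V)
  have hn : ¬ (Walk.cons h q).IsPath := by
    intro hp
    have := hp.length_lt
    simp [hm] at this
  obtain ⟨x, c, hc, -, hce⟩ := hr.exists_isCycle hn
  refine (girth_le_length hc).trans ?_
  rw [← Walk.length_edges, ← List.toFinset_card_of_nodup hc.edges_nodup]
  exact Finset.card_le_card fun e h => he e (hce (List.mem_toFinset.1 h))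

/-- The edges which a walk uses an odd number of times. -/
noncomputable def oddEdges {u v : V} (p : G.Walk u v) : Finset (Sym2 V) :=
  p.edges.toFinset.filter fun e => Odd (p.edges.count e)

lemma mem_oddEdges {u v : V} (p : G.Walk u v) (e : Sym2 V) :
    e ∈ oddEdges p ↔ Odd (p.edges.count e) := by
  rw [oddEdges, Finset.mem_filter, and_iff_right_iff_imp, List.mem_toFinset]
  exact fun h => List.count_pos_iff.1 h.pos

lemma oddEdges_reduce {u v : V} (p : G.Walk u v) : oddEdges (reduce p) = oddEdges p := by
  ext e
  rw [mem_oddEdges, mem_oddEdges, odd_count_edges_reduce]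

lemma oddEdges_of_isTrail {u v : V} {p : G.Walk u v} (hp : p.IsTrail) :
    oddEdges p = p.edges.toFinset := by
  ext e
  rw [mem_oddEdges, List.mem_toFinset]
  by_cases he : e ∈ p.edges
  · rw [List.count_eq_one_of_mem hp.edges_nodup he]
    simp [he]
  · rw [List.count_eq_zero_of_not_mem he]
    simp [he]

lemma oddEdges_subset {u v : V} (p : G.Walk u v) :
    oddEdges p ⊆ p.edges.toFinset := by
  intro e he
  rw [mem_oddEdges] at he
  simpa using List.count_pos_iff.1 he.pos

/-- Each passage through `x` uses two edges at `x`; only the two ends of the walk contribute a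
single one. -/
lemma even_countP_mem_edges {u v : V} (p : G.Walk u v) (x : V) :
    Even (p.edges.countP (x ∈ ·) + (if x = u then 1 else 0) + (if x = v then 1 else 0)) := by
  induction p with
  | nil => simp [← two_mul, Nat.even_iff]; split_ifs <;> rfl
  | @cons u y w h p ih =>
    have hne := h.ne
    simp only [Walk.edges_cons, List.countP_cons, Sym2.mem_iff, decide_eq_true_eq]
    split_ifs at ih ⊢ <;> grind

lemma isEvenEdgeSet_oddEdges {u : V} (p : G.Walk u u) : IsEvenEdgeSet (oddEdges p) := by
  intro x
  have h := even_countP_mem_edges p x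
  have h1 : Even (p.edges.countP (x ∈ ·)) := by grind
  rw [List.countP_eq_length_filter, ← List.sum_toFinset_count_eq_length,
    Finset.even_sum_iff_even_card_odd] at h1
  convert h1 using 2
  ext e
  simp only [Finset.mem_filter, mem_oddEdges, List.mem_toFinset, List.mem_filter,
    decide_eq_true_eq]
  constructor
  · rintro ⟨h1, h2⟩
    rw [List.count_filter (by simpa using h2)]
    exact ⟨⟨List.count_pos_iff.1 h1.pos, h2⟩, h1⟩
  · rintro ⟨⟨h1, h2⟩, h3⟩
    rw [List.count_filter (by simpa using h2)] at h3
    exact ⟨h3, h2⟩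

/-- An even set of edges of a closed walk shorter than twice the girth is empty or consists of the
edges which the walk uses an odd number of times. -/
lemma IsEvenEdgeSet.eq_oddEdges [Fintype V] {u : V} {w : G.Walk u u}
    (hl : w.length < 2 * G.girth) {D : Finset (Sym2 V)} (hD : IsEvenEdgeSet D)
    (hDw : D ⊆ w.edges.toFinset) (hne : D.Nonempty) : D = oddEdges w := by
  by_contra hDF
  have hE : ∀ e ∈ w.edges.toFinset, e ∈ G.edgeSet := fun e he =>
    w.edges_subset_edgeSet (List.mem_toFinset.1 he)
  have hFw := oddEdges_subset w
  have h1 := hD.girth_le_card (G := G) (fun e he => hE e (hDw he)) hne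
  have h2 := (hD.symmDiff_isEvenEdgeSet (isEvenEdgeSet_oddEdges w)).girth_le_card (G := G) (fun e he => by
    rw [Finset.mem_symmDiff] at he
    rcases he with he | he
    · exact hE e (hDw he.1)
    · exact hE e (hFw he.1)) (by
    rw [Finset.nonempty_iff_ne_empty]
    intro h
    exact hDF (symmDiff_eq_bot.1 h))
  -- Edges of `D` outside `oddEdges w` are used a positive even number of times, hence at least
  -- twice. The left side equals the size of `D` plus that of the symmetric difference, so it is at
  -- least twice the girth.
  have h3 : (oddEdges w).card + 2 * (D \ oddEdges w).card ≤ w.length := by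
    rw [← Walk.length_edges, ← List.sum_toFinset_count_eq_length]
    calc (oddEdges w).card + 2 * (D \ oddEdges w).card
        ≤ ∑ e ∈ oddEdges w, w.edges.count e + ∑ e ∈ D \ oddEdges w, w.edges.count e := by
          rw [Finset.card_eq_sum_ones, mul_comm, ← smul_eq_mul, ← Finset.sum_const]
          refine add_le_add (Finset.sum_le_sum fun e he => ?_) (Finset.sum_le_sum fun e he => ?_)
          · exact Nat.succ_le_of_lt ((mem_oddEdges _ _).1 he).pos
          · rw [Finset.mem_sdiff, mem_oddEdges] at he
            have := List.count_pos_iff.2 (List.mem_toFinset.1 (hDw he.1))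
            grind
      _ = ∑ e ∈ oddEdges w ∪ (D \ oddEdges w), w.edges.count e :=
          (Finset.sum_union Finset.disjoint_sdiff).symm
      _ ≤ _ := Finset.sum_le_sum_of_subset
          (Finset.union_subset hFw (Finset.sdiff_subset.trans hDw))
  have h4 : (symmDiff D (oddEdges w)).card =
      (D \ oddEdges w).card + (oddEdges w \ D).card := by
    rw [symmDiff_def, Finset.sup_eq_union, Finset.card_union_of_disjoint disjoint_sdiff_sdiff]
  have h5 := Finset.card_sdiff_add_card_inter D (oddEdges w)
  have h6 := Finset.card_sdiff_add_card_inter (oddEdges w) D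
  rw [Finset.inter_comm] at h6
  omega

end CycleWalks

/-! ### Reduced form, first hit and direction of a walk containing a cycle -/

namespace CycleWalks

open SimpleGraph

variable {V : Type*} {G : SimpleGraph V}

/-- An inner vertex of `c'` has just two neighbours along `c'`. The walk `c` has come from one of
them and cannot turn back, so its next vertex is forced. -/
lemma _root_.SimpleGraph.Walk.IsCycle.eq_of_snd_eq {x : V} {c c' : G.Walk x x} (hc : c.IsCycle)
    (hc' : c'.IsCycle) (he : c.edges ⊆ c'.edges) (hl : c.length = c'.length)
    (hs : c.snd = c'.snd) : c = c' := by
  have key : ∀ j, j ≤ c.length → c.getVert j = c'.getVert j := by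
    intro j
    induction j using Nat.strongRec with
    | ind j ih =>
      intro hj
      match j with
      | 0 => simp
      | 1 => exact hs
      | j + 2 =>
        have h1 := ih j (by omega) (by omega)
        have h2 := ih (j + 1) (by omega) (by omega)
        have h3 := c.toSubgraph_adj_getVert (i := j + 1) (by omega)
        rw [Walk.adj_toSubgraph_iff_mem_edges] at h3
        have h4 := he h3
        rw [← Walk.adj_toSubgraph_iff_mem_edges, h2, ← Subgraph.mem_neighborSet,
          hc'.neighborSet_toSubgraph_internal (by omega) (by omega)] at h4
        rcases h4 with h4 | h4
        · have h5 := hc.getVert_sub_one_ne_getVert_add_one (i := j + 1) (by omega)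
          simp only [add_tsub_cancel_right] at h5 h4
          rw [← h1] at h4
          exact absurd h4.symm h5
        · exact h4
  exact Walk.ext_getVert_le_length hl key

lemma _root_.SimpleGraph.Walk.IsCycle.eq_or_eq_reverse {x : V} {c c' : G.Walk x x}
    (hc : c.IsCycle) (hc' : c'.IsCycle) (he : c.edges ⊆ c'.edges) (hl : c.length = c'.length) :
    c = c' ∨ c = c'.reverse := by
  have h1 := c.toSubgraph_adj_snd hc.not_nil
  rw [Walk.adj_toSubgraph_iff_mem_edges] at h1
  have h2 := he h1
  rw [← Walk.adj_toSubgraph_iff_mem_edges, ← Subgraph.mem_neighborSet,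
    hc'.neighborSet_toSubgraph_endpoint] at h2
  rcases h2 with h2 | h2
  · exact Or.inl (hc.eq_of_snd_eq hc' he hl h2)
  · refine Or.inr (hc.eq_of_snd_eq hc'.reverse (by simpa using he) (by simpa using hl) ?_)
    rw [Walk.snd_reverse]
    exact h2

lemma exists_append_first_mem {u v : V} (w : G.Walk u v) (S : Set V) {x : V}
    (hx : x ∈ w.support) (hxS : x ∈ S) : ∃ (y : V) (p : G.Walk u y) (q : G.Walk y v),
      w = p.append q ∧ y ∈ S ∧ ∀ m < p.length, p.getVert m ∉ S := by
  induction w with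
  | nil =>
    rw [Walk.support_nil, List.mem_singleton] at hx
    subst hx
    exact ⟨x, .nil, .nil, rfl, hxS, by simp⟩
  | @cons u v w h r ih =>
    by_cases hu : u ∈ S
    · exact ⟨u, .nil, .cons h r, rfl, hu, by simp⟩
    · rw [Walk.support_cons, List.mem_cons] at hx
      rcases hx with rfl | hx
      · exact absurd hxS hu
      · obtain ⟨y, p, q, rfl, hy, hm⟩ := ih hx
        refine ⟨y, .cons h p, q, rfl, hy, fun m hm' => ?_⟩
        cases m with
        | zero => simpa using hu
        | succ m =>
          rw [Walk.getVert_cons_succ]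
          exact hm m (by simpa using hm')

lemma IsFirstHit.eq {a u w v v' : V} {C : G.Walk a a} {p : G.Walk u w} (h : IsFirstHit C p v)
    (h' : IsFirstHit C p v') : v = v' := by
  obtain ⟨hv, n, hn, rfl, hm⟩ := h
  obtain ⟨hv', n', hn', rfl, hm'⟩ := h'
  rcases lt_trichotomy n n' with h | rfl | h
  · exact absurd hv (hm' n h)
  · rfl
  · exact absurd hv' (hm n' h)

/-- The edges of the reduced form are a sublist of those of `w`, and every edge of the tail occurs
in it twice. -/
lemma not_isCycle_of_reduce_eq {z x : V} {w : G.Walk z z} {q : G.Walk z x} {c : G.Walk x x}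
    (hw : reduce w = q.append (c.append q.reverse)) (hq : ¬ q.Nil) : ¬ w.IsCycle := by
  intro h
  have h1 := h.edges_nodup.sublist (edges_reduce_sublist w)
  rw [hw] at h1
  simp only [Walk.edges_append, Walk.edges_reverse, List.nodup_append, List.mem_append,
    List.mem_reverse] at h1
  obtain ⟨e, he⟩ := List.exists_mem_of_ne_nil q.edges (by simpa [Walk.edges_eq_nil] using hq)
  exact h1.2.2 e he e (Or.inr he) rfl

/-- A shortest path is reduced as well, and the two walks together are too short to differ. -/
lemma dist_eq_length_of_isReduced {u v : V} {q : G.Walk u v} (hq : IsReduced q)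
    (hl : 2 * q.length < G.girth) : G.dist u v = q.length := by
  obtain ⟨p, hp, hpl⟩ := q.reachable.exists_path_of_dist
  have := G.dist_le q
  rw [← hpl, hp.isTrail.isReduced.eq_of_length_add_lt hq (by omega)]

variable [DecidableEq V]

lemma oddEdges_lollipop {u x : V} (q : G.Walk u x) (c : G.Walk x x) :
    oddEdges (q.append (c.append q.reverse)) = oddEdges c := by
  ext e
  rw [mem_oddEdges, mem_oddEdges]
  simp only [Walk.edges_append, Walk.edges_reverse, List.count_append, List.count_reverse]
  grind

lemma mem_support_iff_of_edges_eq {x y : V} {c : G.Walk x x} {C : G.Walk y y} (hc : c.IsCycle)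
    (hC : C.IsCycle) (he : c.edges.toFinset = C.edges.toFinset) (v : V) :
    v ∈ c.support ↔ v ∈ C.support := by
  have key : ∀ {a b : V} (p : G.Walk a a) (q : G.Walk b b), p.IsCycle →
      p.edges.toFinset = q.edges.toFinset → v ∈ p.support → v ∈ q.support := by
    intro a b p q hp h hv
    obtain ⟨e, he, hve⟩ := (Walk.mem_support_iff_exists_mem_edges_of_not_nil hp.not_nil).1 hv
    have : e ∈ q.edges := by
      rw [← List.mem_toFinset, ← h, List.mem_toFinset]; exact he
    exact Walk.mem_support_of_mem_edges this hve
  exact ⟨key c C hc he, key C c hC he.symm⟩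

/-- The reduced form of a short closed walk around a cycle. -/
lemma exists_reduce_eq_lollipop [Fintype V] {a z : V} {C : G.Walk a a} (hC : C.IsCycle)
    {w : G.Walk z z} (hl : w.length < 2 * G.girth) (hCw : C.edges ⊆ w.edges) :
    ∃ (x : V) (q : G.Walk z x) (c : G.Walk x x), c.IsCycle ∧
      reduce w = q.append (c.append q.reverse) ∧ c.edges.toFinset = C.edges.toFinset := by
  have h1 : oddEdges C = C.edges.toFinset := oddEdges_of_isTrail hC.isTrail
  have h2 : (oddEdges C).Nonempty := by
    rw [h1, List.toFinset_nonempty_iff]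
    simpa [Walk.edges_eq_nil] using hC.not_nil
  have h3 : oddEdges C = oddEdges w := (isEvenEdgeSet_oddEdges C).eq_oddEdges hl
    (by rw [h1]; exact fun e h => List.mem_toFinset.2 (hCw (List.mem_toFinset.1 h))) h2
  have hl' : (reduce w).length < 2 * G.girth := (length_reduce_le w).trans_lt hl
  have hn : ¬ (reduce w).Nil := by
    intro hn
    have : oddEdges (reduce w) = ∅ := by
      rw [hn.eq_nil]; rfl
    rw [oddEdges_reduce, ← h3] at this
    exact h2.ne_empty this
  obtain ⟨x, q, c, hc, e⟩ := (isReduced_reduce w).exists_lollipop hn hl'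
  refine ⟨x, q, c, hc, e, ?_⟩
  rw [← h1, h3, ← oddEdges_reduce, e, oddEdges_lollipop, oddEdges_of_isTrail hc.isTrail]

/-- A short closed walk whose reduced form is a cycle with a tail first meets the cycle where the
tail does. -/
lemma isFirstHit_of_reduce_eq [Fintype V] {a z x : V} {C : G.Walk a a} (hC : C.IsCycle)
    {w : G.Walk z z} (hl : w.length < 2 * G.girth) {q : G.Walk z x} {c : G.Walk x x}
    (hc : c.IsCycle) (hw : reduce w = q.append (c.append q.reverse))
    (he : c.edges.toFinset = C.edges.toFinset) : IsFirstHit C w x := by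
  have hmem := mem_support_iff_of_edges_eq hc hC he
  have hR : IsReduced (q.append (c.append q.reverse)) := hw ▸ isReduced_reduce w
  have hRl : (q.append (c.append q.reverse)).length < 2 * G.girth :=
    hw ▸ (length_reduce_le w).trans_lt hl
  have hRw : ∀ e ∈ (q.append (c.append q.reverse)).edges, e ∈ w.edges := fun e he =>
    (edges_reduce_sublist w).subset (hw ▸ he)
  have hcn : ¬ c.Nil := hc.not_nil
  have hxw : x ∈ w.support := by
    have h1 := hRw s(x, c.snd) (by
      have := c.toSubgraph_adj_snd hcn
      rw [Walk.adj_toSubgraph_iff_mem_edges] at this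
      simp [Walk.edges_append, this])
    exact Walk.fst_mem_support_of_mem_edges _ h1
  obtain ⟨y, p, r, hpr, hy, hm⟩ :=
    exists_append_first_mem w {v | v ∈ c.support} hxw c.start_mem_support
  have hfirst : IsFirstHit C w y := by
    refine ⟨(hmem y).1 hy, p.length, by simp [hpr], by simp [hpr, Walk.getVert_append], ?_⟩
    intro m hm'
    have := hm m hm'
    rw [hpr, Walk.getVert_append, if_pos hm', ← hmem]
    exact this
  suffices hyx : y = x from hyx ▸ hfirst
  -- If `y ≠ x`, follow `q` backwards to `z`, then `p` to `y`, then the arc `d` of `c` back to `x`.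
  -- Neither `p` nor `q` uses an edge of `c`, so the odd edges of this closed walk include `d` and
  -- miss the other arc `b`. They form a nonempty even set of edges of `w`, which would have to be
  -- all of `c`.
  by_contra hyx
  obtain ⟨b, d, hbd⟩ := Walk.mem_support_iff_exists_append.1 hy
  have hpc : ∀ t ∈ p.support, t ∈ c.support → t = y := by
    intro t ht htc
    obtain ⟨m, rfl, hmp⟩ := Walk.mem_support_iff_exists_getVert.1 ht
    rcases hmp.lt_or_eq with h | rfl
    · exact absurd htc (hm m h)
    · simp
  have hoff : ∀ {s t : V} (k : G.Walk s t) (o : V), (∀ t ∈ k.support, t ∈ c.support → t = o) →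
      ∀ e ∈ c.edges, k.edges.count e = 0 := by
    intro s t k o hk e hec
    rw [List.count_eq_zero]
    intro hek
    induction e with
    | _ e₁ e₂ =>
    have h1 := hk e₁ (k.fst_mem_support_of_mem_edges hek) (c.fst_mem_support_of_mem_edges hec)
    have h2 := hk e₂ (k.snd_mem_support_of_mem_edges hek) (c.snd_mem_support_of_mem_edges hec)
    exact (k.adj_of_mem_edges hek).ne (h1.trans h2.symm)
  have hq0 := hoff q x fun t h1 h2 => hR.eq_of_mem_lollipop hRl h1 h2
  have hp0 := hoff p y hpc
  have hnodup := hc.edges_nodup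
  rw [hbd, Walk.edges_append, List.nodup_append] at hnodup
  have hcount : ∀ e ∈ c.edges, (q.reverse.append (p.append d)).edges.count e =
      d.edges.count e := by
    intro e he
    simp only [Walk.edges_append, Walk.edges_reverse, List.count_append, List.count_reverse,
      hq0 e he, hp0 e he, zero_add]
  have hdn : ¬ d.Nil := fun h => hyx h.eq
  have hbn : ¬ b.Nil := fun h => hyx h.eq.symm
  obtain ⟨e, hed⟩ := List.exists_mem_of_ne_nil d.edges (by simpa [Walk.edges_eq_nil] using hdn)
  obtain ⟨e', heb⟩ := List.exists_mem_of_ne_nil b.edges (by simpa [Walk.edges_eq_nil] using hbn)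
  have hec : e ∈ c.edges := by rw [hbd, Walk.edges_append]; exact List.mem_append_right _ hed
  have hec' : e' ∈ c.edges := by rw [hbd, Walk.edges_append]; exact List.mem_append_left _ heb
  have heD : e ∈ oddEdges (q.reverse.append (p.append d)) := by
    rw [mem_oddEdges, hcount e hec, List.count_eq_one_of_mem hnodup.2.1 hed]
    exact odd_one
  have heD' : e' ∉ oddEdges (q.reverse.append (p.append d)) := by
    rw [mem_oddEdges, hcount e' hec', List.count_eq_zero_of_not_mem fun h =>
      hnodup.2.2 e' heb e' h rfl]
    simp
  have hD := (isEvenEdgeSet_oddEdges (q.reverse.append (p.append d))).eq_oddEdges hl (by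
    intro f hf
    have hf' := List.mem_toFinset.1 (oddEdges_subset _ hf)
    rw [List.mem_toFinset]
    simp only [Walk.edges_append, Walk.edges_reverse, List.mem_append, List.mem_reverse] at hf'
    rcases hf' with hf' | hf' | hf'
    · exact hRw f (by simp [Walk.edges_append, hf'])
    · simp [hpr, Walk.edges_append, hf']
    · exact hRw f (by simp [Walk.edges_append, hbd, hf'])) ⟨e, heD⟩
  rw [hD, ← oddEdges_reduce, hw, oddEdges_lollipop, oddEdges_of_isTrail hc.isTrail,
    List.mem_toFinset] at heD'
  exact heD' hec'

/-- Steps along `C` minus steps against it is invariant under reduction. In the reduced form the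
tail cancels against its reverse, and `c` contributes `C.length`. -/
lemma hasDirection_of_reduce_eq {a z x : V} {C : G.Walk a a} (hC : C.IsCycle)
    {w : G.Walk z z} {q : G.Walk z x} {c : G.Walk x x}
    (hw : reduce w = q.append (c.append q.reverse)) (hc : c.darts.Perm C.darts) :
    HasDirection C w ∧ ¬ HasDirection C.reverse w := by
  classical
  have key := countP_darts_reduce (fun e => decide (e ∈ C.darts)) w
  rw [hw] at key
  have hcp : c.darts.countP (fun e => decide (e ∈ C.darts)) = C.length := by
    rw [hc.countP_eq, List.countP_eq_length.2 (by simp), Walk.length_darts]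
  have hcn : c.darts.countP (fun e => decide (e.symm ∈ C.darts)) = 0 := by
    rw [hc.countP_eq, List.countP_eq_zero]
    intro e he
    simp only [decide_eq_true_eq]
    intro he'
    have hnd : (C.darts.map Dart.edge).Nodup := hC.edges_nodup
    exact e.symm_ne (List.inj_on_of_nodup_map hnd he' he e.edge_symm)
  have hrev : ∀ S : G.Dart → Bool, q.reverse.darts.countP S =
      q.darts.countP (fun e => S e.symm) := by
    intro S
    rw [Walk.darts_reverse, List.countP_reverse, List.countP_map]
    rfl
  simp only [Walk.darts_append, List.countP_append, hrev, Dart.symm_symm, hcp, hcn] at key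
  have hpos : 0 < C.length := by
    have := hC.three_le_length
    omega
  unfold HasDirection
  simp only [Walk.mem_darts_reverse, Dart.symm_symm]
  constructor
  · convert (by omega : w.darts.countP (fun e => decide (e.symm ∈ C.darts)) <
      w.darts.countP (fun e => decide (e ∈ C.darts)))
  · convert (by omega : ¬ w.darts.countP (fun e => decide (e ∈ C.darts)) <
      w.darts.countP (fun e => decide (e.symm ∈ C.darts)))

end CycleWalks

/-! ### The walks of 𝔚(v, l) in terms of reduced forms -/

namespace CycleWalks

open SimpleGraph

variable {V : Type*} {G : SimpleGraph V}

lemma toSubgraph_le_toSubgraph_iff {a b u v : V} {C : G.Walk a b} (hC : ¬ C.Nil)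
    {w : G.Walk u v} : C.toSubgraph ≤ w.toSubgraph ↔ C.edges ⊆ w.edges := by
  rw [Walk.toSubgraph_le_iff hC, Walk.edgeSet_toSubgraph]
  rfl

lemma HasDirection.not_reverse {a u v : V} {C : G.Walk a a} {p : G.Walk u v}
    (h : HasDirection C p) : ¬ HasDirection C.reverse p := by
  classical
  intro h'
  unfold HasDirection at h h'
  simp only [Walk.mem_darts_reverse, Dart.symm_symm] at h'
  exact lt_asymm h (by convert h')

variable [DecidableEq V] [Fintype V]

/-- Structure of a short closed walk off a cycle whose edges it contains. -/
lemma exists_reduce_eq_rotate {a z : V} {C : G.Walk a a} (hC : C.IsCycle) {k : ℕ}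
    (hik : C.length + 2 * k < 2 * G.girth) {w : G.Walk z z} (hl : w.length = C.length + 2 * k)
    (hCw : C.edges ⊆ w.edges) (hz : z ∉ C.support) :
    ∃ (x : V) (hx : x ∈ C.support) (q : G.Walk z x) (c : G.Walk x x),
      (c = C.rotate x hx ∨ c = (C.rotate x hx).reverse) ∧
      reduce w = q.append (c.append q.reverse) ∧ 1 ≤ q.length ∧ q.length ≤ k ∧
      IsFirstHit C w x ∧ G.dist z x = q.length ∧ ¬ w.IsCycle := by
  have hl' : w.length < 2 * G.girth := by omega
  obtain ⟨x, q, c, hc, hw, he⟩ := exists_reduce_eq_lollipop hC hl' hCw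
  have hR : IsReduced (q.append (c.append q.reverse)) := hw ▸ isReduced_reduce w
  have hx : x ∈ C.support := (mem_support_iff_of_edges_eq hc hC he x).1 c.start_mem_support
  have hcl : c.length = C.length := by
    rw [← Walk.length_edges, ← Walk.length_edges, ← List.toFinset_card_of_nodup hc.edges_nodup,
      ← List.toFinset_card_of_nodup hC.edges_nodup, he]
  have hRl := length_reduce_le w
  rw [hw] at hRl
  simp only [Walk.length_append, Walk.length_reverse] at hRl
  have hqn : ¬ q.Nil := fun h => hz (h.eq ▸ hx)
  -- With `hik` this yields `2 * k < G.girth`, so the tail is shorter than half the girth.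
  have hg := SimpleGraph.girth_le_length hC
  refine ⟨x, hx, q, c, ?_, hw, Nat.pos_of_ne_zero fun h => hqn (Walk.length_eq_zero_iff.1 h),
    by omega, isFirstHit_of_reduce_eq hC hl' hc hw he,
    dist_eq_length_of_isReduced hR.of_append_left (by omega), not_isCycle_of_reduce_eq hw hqn⟩
  refine hc.eq_or_eq_reverse ((Walk.isCycle_rotate hx).2 hC) ?_ (by simpa using hcl)
  intro e hec
  rw [(C.rotate_edges x hx).mem_iff, ← List.mem_toFinset, ← he, List.mem_toFinset]
  exact hec

/-- Distance, first hit, direction and containment of `C` are all encoded in the reduced form. What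
remains is to count walks with a prescribed reduced form. -/
lemma mem_walksVia_iff {a v : V} {C : G.Walk a a} (hC : C.IsCycle) {k l : ℕ}
    (hik : C.length + 2 * k < 2 * G.girth) (hv : v ∈ C.support) (hl : 1 ≤ l)
    (w : Σ u : V, G.Walk u u) :
    w ∈ walksVia C k v l ↔ w.2.length = C.length + 2 * k ∧ ∃ q : G.Walk w.1 v,
      q.length = l ∧ reduce w.2 = q.append ((C.rotate v hv).append q.reverse) := by
  obtain ⟨z, w⟩ := w
  constructor
  · rintro ⟨hwl, -, hCw, hdir, hz, hd, hfh⟩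
    refine ⟨hwl, ?_⟩
    obtain ⟨x, hx, q, c, hc, hw, -, -, hfh', hd', -⟩ := exists_reduce_eq_rotate hC hik hwl
      ((toSubgraph_le_toSubgraph_iff hC.not_nil).1 hCw) hz
    obtain rfl := hfh.eq hfh'
    refine ⟨q, hd'.symm.trans hd, ?_⟩
    rcases hc with rfl | rfl
    · exact hw
    · exfalso
      refine (hasDirection_of_reduce_eq (C := C.reverse) hC.reverse hw ?_).2
        (by rwa [Walk.reverse_reverse])
      rw [Walk.darts_reverse, Walk.darts_reverse]
      exact (List.reverse_perm _).trans
        (((C.rotate_darts v hv).perm.map _).trans (List.reverse_perm _).symm)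
  · rintro ⟨hwl, q, hql, hw⟩
    simp only at hwl q hql hw
    have hcC : (C.rotate v hv).IsCycle := (Walk.isCycle_rotate hv).2 hC
    have hR : IsReduced (q.append ((C.rotate v hv).append q.reverse)) :=
      hw ▸ isReduced_reduce w
    have hRl := length_reduce_le w
    rw [hw] at hRl
    have hRl' : (q.append ((C.rotate v hv).append q.reverse)).length < 2 * G.girth := by omega
    simp only [Walk.length_append, Walk.length_reverse, Walk.length_rotate] at hRl
    have hg := SimpleGraph.girth_le_length hC
    have he : (C.rotate v hv).edges.toFinset = C.edges.toFinset :=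
      List.toFinset_eq_of_perm _ _ (C.rotate_edges v hv).perm
    have hqn : ¬ q.Nil := by
      intro h
      rw [← Walk.length_eq_zero_iff] at h
      omega
    refine ⟨hwl, not_isCycle_of_reduce_eq hw hqn,
      (toSubgraph_le_toSubgraph_iff hC.not_nil).2 fun e heC => ?_,
      (hasDirection_of_reduce_eq hC hw (C.rotate_darts v hv).perm).1, ?_,
      (dist_eq_length_of_isReduced hR.of_append_left (by omega)).trans hql,
      isFirstHit_of_reduce_eq hC (by simp only; omega) hcC hw he⟩
    · refine (edges_reduce_sublist w).subset ?_
      rw [hw]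
      simp [Walk.edges_append, (C.rotate_edges v hv).mem_iff, heC]
    · intro hz
      -- A start on `C` would be `v` itself, making the tail a nonempty closed reduced walk shorter
      -- than the girth.
      have hzv := hR.eq_of_mem_lollipop hRl' q.start_mem_support
        ((C.mem_support_rotate_iff v hv).2 hz)
      subst hzv
      have := hR.of_append_left.girth_le_length hqn
      omega

/-- Walks that run round against the direction of `C` are accounted for by `C.reverse`. -/
lemma exists_mem_walksVia {a : V} {C : G.Walk a a} (hC : C.IsCycle) {k : ℕ}
    (hik : C.length + 2 * k < 2 * G.girth) {w : Σ u : V, G.Walk u u}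
    (hl : w.2.length = C.length + 2 * k)
    (hCw : C.toSubgraph ≤ w.2.toSubgraph) (hz : w.1 ∉ C.support) :
    ∃ x ∈ C.support, ∃ l ∈ Finset.Icc 1 k,
      w ∈ walksVia C k x l ∨ w ∈ walksVia C.reverse k x l := by
  obtain ⟨z, w⟩ := w
  obtain ⟨x, hx, q, c, hc, hw, hq1, hqk, hfh, hd, hcy⟩ := exists_reduce_eq_rotate hC hik hl
      ((toSubgraph_le_toSubgraph_iff hC.not_nil).1 hCw) hz
  refine ⟨x, hx, q.length, Finset.mem_Icc.2 ⟨hq1, hqk⟩, ?_⟩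
  rcases hc with rfl | rfl
  · exact Or.inl ⟨hl, hcy, hCw,
      (hasDirection_of_reduce_eq hC hw (C.rotate_darts x hx).perm).1, hz, hd, hfh⟩
  · refine Or.inr ⟨by simpa using hl, hcy, by simpa using hCw, ?_, by simpa using hz, hd,
      by simpa [IsFirstHit] using hfh⟩
    refine (hasDirection_of_reduce_eq (C := C.reverse) hC.reverse hw ?_).1
    rw [Walk.darts_reverse, Walk.darts_reverse]
    exact (List.reverse_perm _).trans
      (((C.rotate_darts x hx).perm.map _).trans (List.reverse_perm _).symm)

end CycleWalks

/-! ### Counting walks with a given reduced form, and counting tails -/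

namespace CycleWalks

open SimpleGraph

variable {V : Type*} {G : SimpleGraph V}

/-- The number of walks of length `n` with a given reduced form of length `r`, in a graph in which
the degrees of adjacent vertices add up to `s`, if the walks start in a vertex of degree `a`. -/
def walkCount (s : ℕ) : ℕ → ℕ → ℕ → ℕ
  | 0, _, r => if r = 0 then 1 else 0
  | n + 1, a, 0 => a * walkCount s n (s - a) 1
  | n + 1, a, r + 1 => walkCount s n (s - a) r + (a - 1) * walkCount s n (s - a) (r + 2)

lemma length_prepend_symm_cons {u v w y : V} (h : G.Adj u v) (p : G.Walk v w) (h' : G.Adj u y) :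
    (y = v → (prepend h'.symm (Walk.cons h p)).length = p.length) ∧
      (y ≠ v → (prepend h'.symm (Walk.cons h p)).length = p.length + 2) := by
  constructor
  · rintro rfl
    rw [prepend_cons_symm h.symm]
  · intro hy
    rcases prepend_eq h'.symm (Walk.cons h p) with ⟨p', hp', -⟩ | ⟨e, -⟩
    · have := congrArg Walk.snd hp'
      simp at this
      exact absurd this.symm hy
    · rw [e]
      simp

/-- Induction on the first step. Stepping to the second vertex of `R` leaves a reduced form shorter
by one; stepping to any other neighbour leaves one longer by one. All neighbours have degree `s -
G.degree x`, so only lengths and degrees matter. -/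
lemma card_walks_reduce_eq [DecidableEq V] [Fintype V] [DecidableRel G.Adj] {s : ℕ}
    (hs : ∀ x y, G.Adj x y → G.degree x + G.degree y = s) (n : ℕ) {x y : V} {R : G.Walk x y}
    (hR : IsReduced R) :
    {w : G.Walk x y | w.length = n ∧ reduce w = R}.ncard =
      walkCount s n (G.degree x) R.length := by
  classical
  have hset : ∀ (n : ℕ) (x : V) (R : G.Walk x y),
      {w : G.Walk x y | w.length = n ∧ reduce w = R} =
      ((G.finsetWalkLength n x y).filter (reduce · = R) : Set (G.Walk x y)) := by
    intro n x R
    ext w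
    simp [mem_finsetWalkLength_iff]
  induction n generalizing x with
  | zero =>
    rw [walkCount]
    split_ifs with h
    · rw [Walk.length_eq_zero_iff] at h
      cases h
      rw [Set.ncard_eq_one]
      refine ⟨.nil, ?_⟩
      ext w
      simp only [Walk.length_eq_zero_iff, Set.mem_ofPred_eq, Set.mem_singleton_iff]
      constructor
      · rintro ⟨h, -⟩
        exact h.eq_nil
      · rintro rfl
        exact ⟨.nil, rfl⟩
    · rw [Set.ncard_eq_zero (by rw [hset]; exact Finset.finite_toSet _),
        Set.eq_empty_iff_forall_notMem]
      rintro w ⟨hw, rfl⟩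
      have := length_reduce_le w
      omega
  | succ n ih =>
    have step : {w : G.Walk x y | w.length = n + 1 ∧ reduce w = R}.ncard =
        ∑ u : G.neighborSet x, walkCount s n (s - G.degree x)
          (prepend (G.adj_symm u.2) R).length := by
      rw [hset, Set.ncard_coe_finset, finsetWalkLength, Finset.filter_biUnion,
        Finset.card_biUnion]
      · refine Finset.sum_congr rfl fun u _ => ?_
        rw [Finset.filter_map, Finset.card_map]
        have hdeg : G.degree u.1 = s - G.degree x := by
          have := hs x u.1 u.2
          omega
        rw [← hdeg, ← ih (isReduced_prepend _ hR), hset, Set.ncard_coe_finset]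
        congr 1
        refine Finset.filter_congr fun w _ => ?_
        exact prepend_eq_iff _ (isReduced_reduce w) hR
      · intro u _ u' _ huu'
        rw [Function.onFun, Finset.disjoint_left]
        intro w hw hw'
        simp only [Finset.mem_filter, Finset.mem_map] at hw hw'
        obtain ⟨⟨p, -, rfl⟩, -⟩ := hw
        obtain ⟨⟨p', -, h⟩, -⟩ := hw'
        have hu : G.Adj x u.1 := u.2
        have hu' : G.Adj x u'.1 := u'.2
        have h : Walk.cons hu' p' = Walk.cons hu p := h
        have := congrArg Walk.snd h
        rw [Walk.snd_cons, Walk.snd_cons] at this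
        exact huu' (Subtype.ext this.symm)
    rw [step]
    cases R with
    | nil =>
      simp only [prepend, Walk.length_cons, Walk.length_nil, Finset.sum_const, Finset.card_univ,
        card_neighborSet_eq_degree, smul_eq_mul, walkCount]
    | @cons _ v _ h p =>
      rw [← Finset.add_sum_erase _ _ (Finset.mem_univ (⟨v, h⟩ : G.neighborSet x)),
        (length_prepend_symm_cons h p h).1 rfl, Finset.sum_congr rfl (g := fun _ =>
          walkCount s n (s - G.degree x) (p.length + 2)), Finset.sum_const,
        Finset.card_erase_of_mem (Finset.mem_univ _), Finset.card_univ, card_neighborSet_eq_degree,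
        smul_eq_mul, Walk.length_cons, walkCount]
      intro u hu
      rw [(length_prepend_symm_cons h p u.2).2 fun e => (Finset.mem_erase.1 hu).1 (Subtype.ext e)]

/-- Steps to and fro along the first edge of `R` pad the length without changing the reduced form.
-/
lemma exists_length_eq_reduce_eq {x y : V} {R : G.Walk x y} (hR : IsReduced R) (hn : ¬ R.Nil)
    (t : ℕ) : ∃ w : G.Walk x y, w.length = R.length + 2 * t ∧ reduce w = R := by
  induction t with
  | zero => exact ⟨R, rfl, reduce_of_isReduced hR⟩
  | succ t ih =>
    obtain ⟨w, hw, hr⟩ := ih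
    have h := R.adj_snd hn
    refine ⟨.cons h (.cons h.symm w), ?_, ?_⟩
    · simp only [Walk.length_cons, hw]
      ring
    · rw [reduce, reduce, hr]
      exact prepend_symm_prepend h.symm hR

lemma degree_eq_of_walk [Fintype V] [DecidableRel G.Adj] {s : ℕ}
    (hs : ∀ x y, G.Adj x y → G.degree x + G.degree y = s) {x y : V} (p : G.Walk x y) :
    G.degree x = if Even p.length then G.degree y else s - G.degree y := by
  induction p with
  | nil => simp
  | @cons u v w h p ih =>
    have h1 := hs u v h
    simp only [Walk.length_cons, Nat.even_add_one]
    split_ifs at ih ⊢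
    · omega
    · by_cases hle : G.degree w ≤ s
      · omega
      · exfalso
        cases p with
        | nil => simp at *
        | cons h' p =>
          have hp : ¬ (Walk.cons h' p).Nil := by simp
          have := hs _ _ ((Walk.cons h' p).adj_penultimate hp)
          omega

/-- The number of reduced continuations of length `m` after a step to a vertex of degree `a`, in a
graph in which the degrees of adjacent vertices add up to `s`. -/
def branchCount (s : ℕ) : ℕ → ℕ → ℕ
  | 0, _ => 1
  | m + 1, a => (a - 1) * branchCount s m (s - a)

/-- The ends of the reduced walks of length `m + 1` whose first step is from `v` to `u`. -/
def branchEnds (G : SimpleGraph V) (v u : V) (m : ℕ) : Set V :=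
  {z | ∃ (h : G.Adj v u) (p : G.Walk u z), p.length = m ∧ IsReduced (Walk.cons h p)}

/-- Two such walks with a common end are together shorter than the girth, hence equal, and so have
the same first step. -/
lemma disjoint_branchEnds {v u u' : V} {m : ℕ} (hm : 2 * (m + 1) < G.girth) (hu : u ≠ u') :
    Disjoint (branchEnds G v u m) (branchEnds G v u' m) := by
  rw [Set.disjoint_left]
  rintro z ⟨h, p, hp, hr⟩ ⟨h', p', hp', hr'⟩
  have := hr.eq_of_length_add_lt hr' (by simp only [Walk.length_cons]; omega)
  have := congrArg Walk.snd this
  simp at this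
  exact hu this

lemma ncard_biUnion_finset {α β : Type*} [Finite β] (S : Finset α) (f : α → Set β) (N : ℕ)
    (hf : ∀ a ∈ S, (f a).ncard = N)
    (hd : ∀ a ∈ S, ∀ b ∈ S, a ≠ b → Disjoint (f a) (f b)) :
    (⋃ a ∈ S, f a).ncard = S.card * N := by
  classical
  have := Fintype.ofFinite β
  have e : (⋃ a ∈ S, f a) = ((S.biUnion fun a => (f a).toFinset : Finset β) : Set β) := by
    ext; simp
  rw [e, Set.ncard_coe_finset, Finset.card_biUnion, Finset.sum_congr rfl (g := fun _ => N)]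
  · simp
  · intro a ha
    rw [← Set.ncard_eq_toFinset_card', hf a ha]
  · intro a ha b hb hab
    simpa using hd a ha b hb hab

lemma ncard_branchEnds [DecidableEq V] [Fintype V] [DecidableRel G.Adj] {s : ℕ}
    (hs : ∀ x y, G.Adj x y → G.degree x + G.degree y = s) {v u : V} (h : G.Adj v u) (m : ℕ)
    (hm : 2 * (m + 1) < G.girth) :
    (branchEnds G v u m).ncard = branchCount s m (G.degree u) := by
  induction m generalizing v u with
  | zero =>
    rw [branchCount, Set.ncard_eq_one]
    refine ⟨u, ?_⟩
    ext z
    rw [Set.mem_singleton_iff]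
    constructor
    · rintro ⟨-, p, hp, -⟩
      exact (Walk.length_eq_zero_iff.1 hp).eq.symm
    · rintro rfl
      exact ⟨h, .nil, rfl, isReduced_singleton h⟩
  | succ m ih =>
    have e : branchEnds G v u (m + 1) =
        ⋃ y ∈ (G.neighborFinset u).erase v, branchEnds G u y m := by
      ext z
      simp only [Set.mem_iUnion, Finset.mem_erase, mem_neighborFinset, exists_prop]
      constructor
      · rintro ⟨h', p, hp, hr⟩
        cases p with
        | nil => simp at hp
        | @cons _ y _ hy p =>
          rw [isReduced_cons_cons] at hr
          exact ⟨y, ⟨hr.1, hy⟩, hy, p, by simpa using hp, hr.2⟩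
      · rintro ⟨y, ⟨hyv, -⟩, hy, p, hp, hr⟩
        exact ⟨h, .cons hy p, by simp [hp], (isReduced_cons_cons _ _ _).2 ⟨hyv, hr⟩⟩
    rw [e, ncard_biUnion_finset _ _ (branchCount s m (s - G.degree u)),
      Finset.card_erase_of_mem (by simpa using h.symm), card_neighborFinset_eq_degree, branchCount]
    · intro y hy
      have hy' : G.Adj u y := by simpa using (Finset.mem_erase.1 hy).2
      have := hs u y hy'
      rw [ih hy' (by omega), ← this, Nat.add_sub_cancel_left]
    · intro y _ y' _ hne
      exact disjoint_branchEnds (by omega) hne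

lemma getLast?_edges {u v : V} {c : G.Walk u v} (hc : ¬ c.Nil) :
    c.edges.getLast? = some s(c.penultimate, v) := by
  have h := c.adj_penultimate hc
  have e : c.dropLast.concat h = c := by simp
  conv_lhs => rw [← e, Walk.edges_concat, List.concat_eq_append, List.getLast?_concat]

lemma isReduced_append_cons {v u z w : V} {c : G.Walk w v} (hc : ¬ c.Nil) (hcr : IsReduced c)
    (h : G.Adj v u) (p : G.Walk u z) : IsReduced (c.append (Walk.cons h p)) ↔
      IsReduced (Walk.cons h p) ∧ u ≠ c.penultimate := by
  rw [isReduced_append, getLast?_edges hc]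
  simp only [hcr, true_and, Option.mem_def, Option.some.injEq, Walk.edges_cons, List.head?_cons,
    forall_eq']
  refine and_congr_right fun _ => not_congr ?_
  rw [Sym2.eq_iff]
  constructor
  · rintro (⟨-, h1⟩ | ⟨h1, -⟩)
    · exact absurd h1 h.ne
    · exact h1.symm
  · rintro rfl
    exact Or.inr ⟨rfl, rfl⟩

/-- Backtracking can occur only at the two junctions of tail and cycle, so the tail must leave `v`
away from both its neighbours on the cycle. This is the source of the factor `G.degree v - 2`. -/
lemma isReduced_lollipop_iff {v u z : V} {c : G.Walk v v} (hc : c.IsCycle) (h : G.Adj v u)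
    (p : G.Walk u z) :
    IsReduced ((Walk.cons h p).reverse.append (c.append (Walk.cons h p))) ↔
      IsReduced (Walk.cons h p) ∧ u ≠ c.penultimate ∧ u ≠ c.snd := by
  have h1 := isReduced_append_cons hc.not_nil hc.isTrail.isReduced h p
  have h2 := isReduced_append_cons hc.reverse.not_nil hc.reverse.isTrail.isReduced h p
  rw [Walk.penultimate_reverse] at h2
  have h3 : IsReduced ((Walk.cons h p).reverse.append c) ↔
      IsReduced (c.reverse.append (Walk.cons h p)) := by
    rw [← isReduced_reverse, Walk.reverse_append, Walk.reverse_reverse]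
  constructor
  · intro hr
    have a1 := hr.of_append_right
    rw [Walk.append_assoc] at hr
    have a2 := hr.of_append_left
    rw [h3, h2] at a2
    rw [h1] at a1
    exact ⟨a1.1, a1.2, a2.2⟩
  · rintro ⟨a1, a2, a3⟩
    exact (h3.2 (h2.2 ⟨a1, a3⟩)).append_append (h1.2 ⟨a1, a2⟩) hc.not_nil

end CycleWalks

/-! ### Cardinalities of N_l(v), Λ^z_v(l) and 𝔚(v, l) -/

namespace CycleWalks

open SimpleGraph

variable {V : Type*} {G : SimpleGraph V} [DecidableEq V] [Fintype V]

/-- Every admissible tail is realised: the lollipop has length `C.length + 2 * l`, and the surplus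
`2 * (k - l)` is filled with backtracking. -/
lemma mem_initialVertices_iff {a v : V} {C : G.Walk a a} (hC : C.IsCycle) {k l : ℕ}
    (hik : C.length + 2 * k < 2 * G.girth) (hv : v ∈ C.support) (hl : 1 ≤ l) (hlk : l ≤ k)
    (z : V) : z ∈ initialVertices C k v l ↔ ∃ q : G.Walk z v, q.length = l ∧
      IsReduced (q.append ((C.rotate v hv).append q.reverse)) := by
  constructor
  · rintro ⟨w, hw, rfl⟩
    rw [mem_walksVia_iff hC hik hv hl] at hw
    obtain ⟨-, q, hq, hr⟩ := hw
    exact ⟨q, hq, hr ▸ isReduced_reduce _⟩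
  · rintro ⟨q, hq, hr⟩
    have hn : ¬ (q.append ((C.rotate v hv).append q.reverse)).Nil := by
      intro h
      rw [← Walk.length_eq_zero_iff, Walk.length_append] at h
      omega
    obtain ⟨w, hw, hwr⟩ := exists_length_eq_reduce_eq hr hn (k - l)
    refine ⟨⟨z, w⟩, (mem_walksVia_iff hC hik hv hl _).2 ⟨?_, q, hq, hwr⟩, rfl⟩
    simp only [Walk.length_append, Walk.length_reverse, Walk.length_rotate] at hw
    simp only
    omega

lemma initialVertices_eq [DecidableRel G.Adj] {a v : V} {C : G.Walk a a} (hC : C.IsCycle)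
    {k m : ℕ} (hik : C.length + 2 * k < 2 * G.girth) (hv : v ∈ C.support) (hm : m + 1 ≤ k) :
    initialVertices C k v (m + 1) =
      ⋃ u ∈ ((G.neighborFinset v).erase (C.rotate v hv).penultimate).erase (C.rotate v hv).snd,
        branchEnds G v u m := by
  have hc : (C.rotate v hv).IsCycle := (Walk.isCycle_rotate hv).2 hC
  ext z
  rw [mem_initialVertices_iff hC hik hv (by omega) hm]
  simp only [Set.mem_iUnion, Finset.mem_erase, mem_neighborFinset, exists_prop]
  constructor
  · rintro ⟨q, hq, hr⟩
    obtain ⟨p, rfl⟩ : ∃ p : G.Walk v z, q = p.reverse := ⟨q.reverse, q.reverse_reverse.symm⟩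
    cases p with
    | nil => simp at hq
    | @cons _ u _ h p =>
      rw [Walk.reverse_reverse, isReduced_lollipop_iff hc] at hr
      exact ⟨u, ⟨hr.2.2, hr.2.1, h⟩, h, p, by simpa using hq, hr.1⟩
  · rintro ⟨u, ⟨hu1, hu2, -⟩, h, p, hp, hr⟩
    refine ⟨(Walk.cons h p).reverse, by rw [Walk.length_reverse, Walk.length_cons, hp], ?_⟩
    rw [Walk.reverse_reverse, isReduced_lollipop_iff hc]
    exact ⟨hr, hu2, hu1⟩

lemma ncard_initialVertices [DecidableRel G.Adj] {s : ℕ}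
    (hs : ∀ x y, G.Adj x y → G.degree x + G.degree y = s) {a v : V} {C : G.Walk a a}
    (hC : C.IsCycle) {k m : ℕ} (hik : C.length + 2 * k < 2 * G.girth) (hv : v ∈ C.support)
    (hm : m + 1 ≤ k) :
    (initialVertices C k v (m + 1)).ncard =
      (G.degree v - 2) * branchCount s m (s - G.degree v) := by
  have hc : (C.rotate v hv).IsCycle := (Walk.isCycle_rotate hv).2 hC
  have hg := SimpleGraph.girth_le_length hC
  rw [initialVertices_eq hC hik hv hm,
    ncard_biUnion_finset _ _ (branchCount s m (s - G.degree v)),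
    Finset.card_erase_of_mem, Finset.card_erase_of_mem, card_neighborFinset_eq_degree,
    Nat.sub_sub]
  · simpa using ((C.rotate v hv).adj_penultimate hc.not_nil).symm
  · simpa [hc.snd_ne_penultimate] using (C.rotate v hv).adj_snd hc.not_nil
  · intro u hu
    simp only [Finset.mem_erase, mem_neighborFinset] at hu
    have := hs v u hu.2.2
    rw [ncard_branchEnds hs hu.2.2 m (by omega), ← this, Nat.add_sub_cancel_left]
  · intro u _ u' _ hne
    exact disjoint_branchEnds (by omega) hne

/-- The tail from `z` to `v` is unique, so all these walks share one reduced form; the degree of `z`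
follows from the parity of `l`. The right side therefore does not involve `z`. -/
lemma ncard_walksViaFrom [DecidableRel G.Adj] {s : ℕ}
    (hs : ∀ x y, G.Adj x y → G.degree x + G.degree y = s) {a v : V} {C : G.Walk a a}
    (hC : C.IsCycle) {k l : ℕ} (hik : C.length + 2 * k < 2 * G.girth) (hv : v ∈ C.support)
    (hl : 1 ≤ l) (hlk : l ≤ k) {z : V} (hz : z ∈ initialVertices C k v l) :
    (walksViaFrom C k v l z).ncard = walkCount s (C.length + 2 * k)
      (if Even l then G.degree v else s - G.degree v) (C.length + 2 * l) := by
  have hg := SimpleGraph.girth_le_length hC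
  obtain ⟨q, hq, hr⟩ := (mem_initialVertices_iff hC hik hv hl hlk z).1 hz
  have e : walksViaFrom C k v l z = Sigma.mk (β := fun u => G.Walk u u) z '' {w : G.Walk z z |
      w.length = C.length + 2 * k ∧
        reduce w = q.append ((C.rotate v hv).append q.reverse)} := by
    ext ⟨y, w⟩
    simp only [walksViaFrom, Set.mem_ofPred_eq, mem_walksVia_iff hC hik hv hl]
    constructor
    · rintro ⟨⟨hw, q', hq', hr'⟩, rfl⟩
      have hR' : IsReduced (q'.append ((C.rotate v hv).append q'.reverse)) :=
        hr' ▸ isReduced_reduce _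
      obtain rfl := hR'.of_append_left.eq_of_length_add_lt hr.of_append_left (by omega)
      exact ⟨w, ⟨hw, hr'⟩, rfl⟩
    · rintro ⟨w', ⟨hw, hr'⟩, he⟩
      cases he
      exact ⟨⟨hw, q, hq, hr'⟩, rfl⟩
  rw [e, Set.ncard_image_of_injective _ sigma_mk_injective, card_walks_reduce_eq hs _ hr,
    degree_eq_of_walk hs q, hq]
  congr 1
  simp only [Walk.length_append, Walk.length_reverse, Walk.length_rotate, hq]
  ring

lemma finite_walks_length (G : SimpleGraph V) (n : ℕ) :
    {w : Σ u : V, G.Walk u u | w.2.length = n}.Finite := by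
  classical
  have : {w : Σ u : V, G.Walk u u | w.2.length = n} =
      ((Finset.univ.sigma fun u => G.finsetWalkLength n u u : Finset (Σ u : V, G.Walk u u)) :
        Set _) := by
    ext w
    simp [mem_finsetWalkLength_iff]
  rw [this]
  exact Finset.finite_toSet _

lemma finite_walksVia {a : V} (C : G.Walk a a) (k : ℕ) (v : V) (l : ℕ) :
    (walksVia C k v l).Finite :=
  (finite_walks_length G (C.length + 2 * k)).subset fun _ hw => hw.1

lemma finite_closedWalksOff (G : SimpleGraph V) (i k : ℕ) : (closedWalksOff G i k).Finite :=
  (finite_walks_length G (i + 2 * k)).subset fun _ hw => hw.1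

lemma ncard_eq_sum_ncard {α β : Type*} {S : Set α} (hS : S.Finite) (T : Finset β)
    (r : α → β → Prop) (hex : ∀ x ∈ S, ∃ t ∈ T, r x t)
    (huniq : ∀ x ∈ S, ∀ t ∈ T, ∀ t' ∈ T, r x t → r x t' → t = t') :
    S.ncard = ∑ t ∈ T, {x | x ∈ S ∧ r x t}.ncard := by
  classical
  lift S to Finset α using hS
  have e : S = T.biUnion fun t => S.filter fun x => r x t := by
    ext x
    simp only [Finset.mem_biUnion, Finset.mem_filter]
    constructor
    · intro hx
      obtain ⟨t, ht, h⟩ := hex x hx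
      exact ⟨t, ht, hx, h⟩
    · rintro ⟨t, -, hx, -⟩
      exact hx
  have e' : ∀ t, {x | x ∈ (S : Set α) ∧ r x t} = ((S.filter fun x => r x t : Finset α) : Set α) := by
    intro t; ext; simp
  simp only [e', Set.ncard_coe_finset]
  conv_lhs => rw [e]
  refine Finset.card_biUnion fun t ht t' ht' hne => ?_
  rw [Function.onFun, Finset.disjoint_left]
  intro x hx hx'
  rw [Finset.mem_filter] at hx hx'
  exact hne (huniq x hx.1 t ht t' ht' hx.2 hx'.2)

lemma ncard_walksVia_eq_mul {a v : V} (C : G.Walk a a) {k l N : ℕ}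
    (hN : ∀ z ∈ initialVertices C k v l, (walksViaFrom C k v l z).ncard = N) :
    (walksVia C k v l).ncard = (initialVertices C k v l).ncard * N := by
  have hf : (initialVertices C k v l).Finite := Set.toFinite _
  rw [ncard_eq_sum_ncard (finite_walksVia C k v l) hf.toFinset (fun w z => w.1 = z),
    Finset.sum_congr rfl (g := fun _ => N), Finset.sum_const, smul_eq_mul,
    Set.ncard_eq_toFinset_card _ hf]
  · intro z hz
    exact hN z (hf.mem_toFinset.1 hz)
  · intro w hw
    exact ⟨w.1, hf.mem_toFinset.2 ⟨w, hw, rfl⟩, rfl⟩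
  · rintro w - t - t' - rfl rfl
    rfl

/-- The number of walks in `walksVia C k v l`, for a cycle `C` of length `i` and a vertex `v` of
degree `b`, in a graph in which the degrees of adjacent vertices add up to `s`. -/
def viaCount (s i k b l : ℕ) : ℕ :=
  (b - 2) * branchCount s (l - 1) (s - b) *
    walkCount s (i + 2 * k) (if Even l then b else s - b) (i + 2 * l)

lemma ncard_walksVia [DecidableRel G.Adj] {s : ℕ}
    (hs : ∀ x y, G.Adj x y → G.degree x + G.degree y = s) {a v : V} {C : G.Walk a a}
    (hC : C.IsCycle) {k l : ℕ} (hik : C.length + 2 * k < 2 * G.girth) (hv : v ∈ C.support)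
    (hl : 1 ≤ l) (hlk : l ≤ k) :
    (walksVia C k v l).ncard = viaCount s C.length k (G.degree v) l := by
  rw [ncard_walksVia_eq_mul C fun z hz => ncard_walksViaFrom hs hC hik hv hl hlk hz]
  obtain ⟨m, rfl⟩ : ∃ m, l = m + 1 := ⟨l - 1, by omega⟩
  rw [ncard_initialVertices hs hC hik hv hlk, viaCount, Nat.add_sub_cancel]

end CycleWalks

/-! ### Summation over the vertices of a cycle and over all cycles -/

namespace CycleWalks

open SimpleGraph

variable {V : Type*} {G : SimpleGraph V}

lemma IsBiregularBipartite.degree_eq_of_adj [Fintype V] [DecidableRel G.Adj] {c d : ℕ}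
    (h : IsBiregularBipartite G c d) {x y : V} (hxy : G.Adj x y) :
    (G.degree x = c ∧ G.degree y = d) ∨ (G.degree x = d ∧ G.degree y = c) := by
  obtain ⟨A, B, -, hAB, hA, hB⟩ := h
  rcases hAB.mem_of_adj hxy with ⟨hx, hy⟩ | ⟨hx, hy⟩
  · exact Or.inl ⟨hA x hx, hB y hy⟩
  · exact Or.inr ⟨hB x hx, hA y hy⟩

lemma isFirstHit_reverse {a u w v : V} {C : G.Walk a a} {p : G.Walk u w} :
    IsFirstHit C.reverse p v ↔ IsFirstHit C p v := by
  simp [IsFirstHit]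

/-- Degrees alternate along a tail starting with `d`, so `d - 1` takes the larger half of the `m`
factors. -/
lemma branchCount_eq (c d m : ℕ) :
    branchCount (c + d) m d = (d - 1) ^ ((m + 1) / 2) * (c - 1) ^ (m / 2) := by
  induction m generalizing c d with
  | zero => simp [branchCount]
  | succ m ih =>
    rw [branchCount, Nat.add_sub_cancel, add_comm c d, ih d c,
      show (m + 1 + 1) / 2 = m / 2 + 1 by omega, pow_succ]
    ring

lemma floor_half (m : ℕ) : ⌊(((m + 1 : ℕ) : ℚ) - 1) / 2⌋₊ = m / 2 := by
  have : (((m + 1 : ℕ) : ℚ) - 1) / 2 = (m : ℚ) / ((2 : ℕ) : ℚ) := by push_cast; ring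
  rw [this, Nat.floor_div_eq_div]

lemma ceil_half (m : ℕ) : ⌈(((m + 1 : ℕ) : ℚ) - 1) / 2⌉₊ = (m + 1) / 2 := by
  have : (((m + 1 : ℕ) : ℚ) - 1) / 2 = (m : ℚ) / 2 := by push_cast; ring
  rw [this]
  apply le_antisymm
  · rw [Nat.ceil_le]
    have h : m ≤ 2 * ((m + 1) / 2) := by omega
    have : (m : ℚ) ≤ 2 * ((m + 1) / 2 : ℕ) := by exact_mod_cast h
    linarith
  · have h := Nat.le_ceil ((m : ℚ) / 2)
    have : (m : ℚ) ≤ 2 * (⌈(m : ℚ) / 2⌉₊ : ℕ) := by linarith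
    have : m ≤ 2 * ⌈(m : ℚ) / 2⌉₊ := by exact_mod_cast this
    omega

variable [DecidableEq V]

lemma two_le_degree_of_mem_cycle [Fintype V] [DecidableRel G.Adj] {a v : V} {C : G.Walk a a}
    (hC : C.IsCycle) (hv : v ∈ C.support) : 2 ≤ G.degree v := by
  have hc : (C.rotate v hv).IsCycle := (Walk.isCycle_rotate hv).2 hC
  rw [← card_neighborFinset_eq_degree]
  refine Finset.one_lt_card.2 ⟨_, ?_, _, ?_, hc.snd_ne_penultimate⟩
  · simpa using (C.rotate v hv).adj_snd hc.not_nil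
  · simpa using ((C.rotate v hv).adj_penultimate hc.not_nil).symm

/-- If `f` has the same sum over the ends of each edge, its sum over a cycle is determined. -/
lemma two_mul_sum_support {a : V} {C : G.Walk a a} (hC : C.IsCycle) {f : V → ℕ} {N : ℕ}
    (hf : ∀ x y, G.Adj x y → f x + f y = N) :
    2 * ∑ v ∈ C.support.toFinset, f v = C.length * N := by
  -- Each vertex of the cycle is the head of exactly one dart and the tail of exactly one; adding
  -- both sums pairs the two ends of every edge.
  have h1 : ∑ v ∈ C.support.toFinset, f v = (C.darts.map fun e => f e.snd).sum := by
    have e : C.support.toFinset = C.support.tail.toFinset := by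
      ext v
      rw [List.mem_toFinset, List.mem_toFinset]
      refine ⟨fun hv => ?_, List.mem_of_mem_tail⟩
      rcases C.mem_support_iff.1 hv with rfl | hv
      · exact Walk.end_mem_tail_support hC.not_nil
      · exact hv
    rw [e, List.sum_toFinset f hC.support_nodup, ← Walk.map_snd_darts, List.map_map]
    rfl
  have h2 : ∑ v ∈ C.support.toFinset, f v = (C.darts.map fun e => f e.fst).sum := by
    have e : C.support.toFinset = C.support.dropLast.toFinset := by
      ext v
      rw [List.mem_toFinset, List.mem_toFinset]
      refine ⟨fun hv => ?_, List.mem_of_mem_dropLast⟩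
      rw [← C.map_fst_darts_append, List.mem_append, List.mem_singleton, C.map_fst_darts] at hv
      rcases hv with hv | rfl
      · exact hv
      · have := hC.not_nil
        cases C with
        | nil => simp at this
        | cons h p => simp [List.dropLast_cons_of_ne_nil]
    rw [e, List.sum_toFinset f hC.nodup_dropLast_support, ← Walk.map_fst_darts, List.map_map]
    rfl
  rw [two_mul]
  nth_rewrite 1 [h2]
  rw [h1, ← List.sum_map_add, ← Walk.length_darts, ← smul_eq_mul, ← List.sum_replicate,
    ← List.map_const']
  congr 1
  exact List.map_congr_left fun e _ => hf _ _ e.adj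

variable [Fintype V]

/-- The closed walks of length `C.length + 2 * k` off a cycle `C` which contain its edges. -/
def closedWalksAround {a : V} (C : G.Walk a a) (k : ℕ) : Set (Σ u : V, G.Walk u u) :=
  {w | w.2.length = C.length + 2 * k ∧ C.toSubgraph ≤ w.2.toSubgraph ∧ w.1 ∉ C.support}

/-- A walk determines the vertex where it first meets `C`, its distance to that vertex and its
direction; the three index the summands. -/
lemma ncard_closedWalksAround {a : V} {C : G.Walk a a} (hC : C.IsCycle) {k : ℕ}
    (hik : C.length + 2 * k < 2 * G.girth) :
    (closedWalksAround C k).ncard = ∑ v ∈ C.support.toFinset, ∑ l ∈ Finset.Icc 1 k,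
      ((walksVia C k v l).ncard + (walksVia C.reverse k v l).ncard) := by
  have hfin : (closedWalksAround C k).Finite :=
    (finite_walks_length G (C.length + 2 * k)).subset fun _ hw => hw.1
  have hsub : ∀ v l, walksVia C k v l ⊆ closedWalksAround C k := fun v l w hw =>
    ⟨hw.1, hw.2.2.1, hw.2.2.2.2.1⟩
  have hsub' : ∀ v l, walksVia C.reverse k v l ⊆ closedWalksAround C k := fun v l w hw =>
    ⟨by simpa using hw.1, by simpa using hw.2.2.1, by simpa using hw.2.2.2.2.1⟩
  rw [ncard_eq_sum_ncard hfin
    (C.support.toFinset ×ˢ Finset.Icc 1 k ×ˢ (Finset.univ : Finset Bool))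
    (fun w t => w ∈ walksVia (bif t.2.2 then C else C.reverse) k t.1 t.2.1)]
  · rw [Finset.sum_product]
    refine Finset.sum_congr rfl fun v _ => ?_
    rw [Finset.sum_product]
    refine Finset.sum_congr rfl fun l _ => ?_
    rw [Fintype.sum_bool]
    congr 2
    · ext w
      exact ⟨fun h => h.2, fun h => ⟨hsub v l h, h⟩⟩
    · ext w
      exact ⟨fun h => h.2, fun h => ⟨hsub' v l h, h⟩⟩
  · rintro w ⟨hw, hCw, hz⟩
    obtain ⟨x, hx, l, hl, h | h⟩ := exists_mem_walksVia hC hik hw hCw hz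
    · exact ⟨(x, l, true), by simp [hx, Finset.mem_Icc.1 hl], h⟩
    · exact ⟨(x, l, false), by simp [hx, Finset.mem_Icc.1 hl], h⟩
  · rintro w - ⟨v, l, b⟩ - ⟨v', l', b'⟩ - h h'
    have hfh : ∀ (b : Bool) (v : V) (l : ℕ), w ∈ walksVia (bif b then C else C.reverse) k v l →
        IsFirstHit C w.2 v := by
      rintro (_ | _) v l h
      · exact isFirstHit_reverse.1 h.2.2.2.2.2.2
      · exact h.2.2.2.2.2.2
    obtain rfl := (hfh b v l h).eq (hfh b' v' l' h')
    obtain rfl : l = l' := h.2.2.2.2.2.1.symm.trans h'.2.2.2.2.2.1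
    have hb : b = b' := by
      cases b <;> cases b'
      · rfl
      · exact absurd h.2.2.2.1 h'.2.2.2.1.not_reverse
      · exact absurd h'.2.2.2.1 h.2.2.2.1.not_reverse
      · rfl
    rw [hb]

/-- No walk is counted for two cycles, since the edges of the cycle are those which the walk uses an
odd number of times. -/
lemma ncard_closedWalksOff {i k N : ℕ} (hik : i + 2 * k < 2 * G.girth)
    (hN : ∀ (a : V) (C : G.Walk a a), C.IsCycle → C.length = i →
      (closedWalksAround C k).ncard = N) :
    (closedWalksOff G i k).ncard = numCycles G i * N := by
  have hf : (cyclesOfLength G i).Finite := Set.toFinite _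
  rw [ncard_eq_sum_ncard (finite_closedWalksOff G i k) hf.toFinset
    (fun w H => H ≤ w.2.toSubgraph ∧ w.1 ∉ H.verts), Finset.sum_congr rfl (g := fun _ => N),
    Finset.sum_const, smul_eq_mul, numCycles, Set.ncard_eq_toFinset_card _ hf]
  · intro H hH
    obtain ⟨a, C, hC, hl, rfl⟩ := hf.mem_toFinset.1 hH
    rw [← hN a C hC hl]
    congr 1
    ext w
    simp only [closedWalksAround, closedWalksOff, Set.mem_ofPred_eq, Walk.mem_verts_toSubgraph]
    constructor
    · rintro ⟨⟨hw, -, -⟩, h1, h2⟩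
      exact ⟨by rw [hl]; exact hw, h1, h2⟩
    · rintro ⟨hw, h1, h2⟩
      refine ⟨⟨by rw [← hl]; exact hw, ?_, C.toSubgraph, hf.mem_toFinset.1 hH, h1,
        by simpa using h2⟩, h1, h2⟩
      -- `closedWalksAround` does not demand that `w` is not a cycle; this follows from membership
      -- in some `walksVia`.
      obtain ⟨x, -, l, -, h | h⟩ := exists_mem_walksVia hC (by omega) hw h1 h2
      · exact h.2.1
      · exact h.2.1
  · rintro w ⟨-, -, H, hH, h⟩
    exact ⟨H, hf.mem_toFinset.2 hH, h⟩
  · rintro ⟨z, w⟩ ⟨hw, -, -⟩ H hH H' hH' ⟨h, -⟩ ⟨h', -⟩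
    obtain ⟨a, C, hC, hl, rfl⟩ := hf.mem_toFinset.1 hH
    obtain ⟨a', C', hC', hl', rfl⟩ := hf.mem_toFinset.1 hH'
    have key : ∀ {b : V} (D : G.Walk b b), D.IsCycle → D.toSubgraph ≤ w.toSubgraph →
        D.edges.toFinset = oddEdges w := by
      intro b D hD hDw
      have hDw' := (toSubgraph_le_toSubgraph_iff hD.not_nil).1 hDw
      have he := oddEdges_of_isTrail hD.isTrail
      rw [← he]
      refine (isEvenEdgeSet_oddEdges D).eq_oddEdges (by simp only at hw; omega) ?_ ?_
      · rw [he]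
        exact fun e h => List.mem_toFinset.2 (hDw' (List.mem_toFinset.1 h))
      · rw [he, List.toFinset_nonempty_iff]
        simpa [Walk.edges_eq_nil] using hD.not_nil
    have he := (key C hC h).trans (key C' hC' h').symm
    have he' : ∀ e, e ∈ C.edges ↔ e ∈ C'.edges := fun e => by
      rw [← List.mem_toFinset, he, List.mem_toFinset]
    exact le_antisymm ((toSubgraph_le_toSubgraph_iff hC.not_nil).2 fun e => (he' e).1)
      ((toSubgraph_le_toSubgraph_iff hC'.not_nil).2 fun e => (he' e).2)

end CycleWalks

/-! ### The main theorem -/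

theorem mainTheorem3 {V : Type*} [Fintype V] (G : SimpleGraph V) [DecidableRel G.Adj]
    (c d : ℕ) (hG : CycleWalks.IsBiregularBipartite G c d)
    (i k : ℕ) (hk : 1 ≤ k) (hik : i + 2 * k < 2 * G.girth) :
    (CycleWalks.numCycles G i = 0 → (CycleWalks.closedWalksOff G i k).ncard = 0) ∧
    ∀ (v₀ : V) (C : G.Walk v₀ v₀), C.IsCycle → C.length = i → G.degree v₀ = c →
      (CycleWalks.closedWalksOff G i k).ncard =
          i * CycleWalks.numCycles G i *
            ∑ l ∈ Finset.Icc 1 k,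
              ((CycleWalks.walksVia C k v₀ l).ncard +
                (CycleWalks.walksVia C k (C.getVert 1) l).ncard) ∧
      ∀ l : ℕ, 1 ≤ l → l ≤ k →
        (∀ z ∈ CycleWalks.initialVertices C k v₀ l,
          (CycleWalks.walksVia C k v₀ l).ncard =
            (CycleWalks.initialVertices C k v₀ l).ncard *
              (CycleWalks.walksViaFrom C k v₀ l z).ncard) ∧
        (∀ z ∈ CycleWalks.initialVertices C k (C.getVert 1) l,
          (CycleWalks.walksVia C k (C.getVert 1) l).ncard =
            (CycleWalks.initialVertices C k (C.getVert 1) l).ncard *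
              (CycleWalks.walksViaFrom C k (C.getVert 1) l z).ncard) ∧
        ((CycleWalks.initialVertices C k v₀ l).ncard : ℤ) =
          ((c : ℤ) - 2) * ((d : ℤ) - 1) ^ ⌈((l : ℚ) - 1) / 2⌉₊ *
            ((c : ℤ) - 1) ^ ⌊((l : ℚ) - 1) / 2⌋₊ ∧
        ((CycleWalks.initialVertices C k (C.getVert 1) l).ncard : ℤ) =
          ((d : ℤ) - 2) * ((c : ℤ) - 1) ^ ⌈((l : ℚ) - 1) / 2⌉₊ *
            ((d : ℤ) - 1) ^ ⌊((l : ℚ) - 1) / 2⌋₊ := by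
  classical
  have hadj : ∀ x y, G.Adj x y →
      (G.degree x = c ∧ G.degree y = d) ∨ (G.degree x = d ∧ G.degree y = c) :=
    fun x y h => hG.degree_eq_of_adj h
  have hs : ∀ x y, G.Adj x y → G.degree x + G.degree y = c + d := by
    intro x y h
    have := hadj x y h
    omega
  constructor
  · intro h0
    have hf : (CycleWalks.cyclesOfLength G i).Finite := Set.toFinite _
    rw [CycleWalks.numCycles, Set.ncard_eq_zero hf] at h0
    rw [Set.ncard_eq_zero (CycleWalks.finite_closedWalksOff G i k),
      Set.eq_empty_iff_forall_notMem]
    rintro w ⟨-, -, H, hH, -⟩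
    rw [h0] at hH
    exact hH
  · intro v₀ C hC hCi hv₀
    have hik' : C.length + 2 * k < 2 * G.girth := by omega
    have hm₀ : v₀ ∈ C.support := C.start_mem_support
    have hm₁ : C.getVert 1 ∈ C.support := C.getVert_mem_support 1
    have hv₁ : G.degree (C.getVert 1) = d := by
      have := hadj v₀ (C.getVert 1) (C.adj_snd hC.not_nil)
      omega
    -- Vertices of a cycle have degree at least 2, so the natural number subtractions agree with the
    -- integer ones in the statement.
    have hc2 : 2 ≤ c := hv₀ ▸ CycleWalks.two_le_degree_of_mem_cycle hC hm₀
    have hd2 : 2 ≤ d := hv₁ ▸ CycleWalks.two_le_degree_of_mem_cycle hC hm₁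
    constructor
    · rw [CycleWalks.ncard_closedWalksOff hik (N := i * ∑ l ∈ Finset.Icc 1 k,
        (CycleWalks.viaCount (c + d) i k c l + CycleWalks.viaCount (c + d) i k d l))]
      · rw [← mul_assoc, mul_comm (CycleWalks.numCycles G i) i]
        congr 1
        refine Finset.sum_congr rfl fun l hl => ?_
        rw [Finset.mem_Icc] at hl
        rw [CycleWalks.ncard_walksVia hs hC hik' hm₀ hl.1 hl.2,
          CycleWalks.ncard_walksVia hs hC hik' hm₁ hl.1 hl.2, hv₀, hv₁, hCi]
      · intro a D hD hDi
        have hikD : D.length + 2 * k < 2 * G.girth := by omega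
        -- The two directions contribute equally, giving twice a sum over the vertices of `D`. The
        -- summands at the ends of an edge always add up to the same value, one end having degree
        -- `c` and the other `d`, so the doubled sum is `D.length` times that value.
        rw [CycleWalks.ncard_closedWalksAround hD hikD, ← hDi,
          ← CycleWalks.two_mul_sum_support hD (f := fun v => ∑ l ∈ Finset.Icc 1 k,
            CycleWalks.viaCount (c + d) D.length k (G.degree v) l), Finset.mul_sum]
        · refine Finset.sum_congr rfl fun v hv => ?_
          rw [Finset.mul_sum]
          refine Finset.sum_congr rfl fun l hl => ?_
          rw [List.mem_toFinset] at hv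
          rw [Finset.mem_Icc] at hl
          rw [CycleWalks.ncard_walksVia hs hD hikD hv hl.1 hl.2,
            CycleWalks.ncard_walksVia hs hD.reverse (by simpa using hikD) (by simpa using hv)
              hl.1 hl.2, SimpleGraph.Walk.length_reverse, two_mul]
        · intro x y hxy
          rw [← Finset.sum_add_distrib]
          refine Finset.sum_congr rfl fun l _ => ?_
          rcases hadj x y hxy with ⟨h1, h2⟩ | ⟨h1, h2⟩
          · rw [h1, h2]
          · rw [h1, h2, add_comm]
    · intro l hl hlk
      have hfib : ∀ v ∈ C.support, ∀ z ∈ CycleWalks.initialVertices C k v l,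
          (CycleWalks.walksVia C k v l).ncard =
            (CycleWalks.initialVertices C k v l).ncard *
              (CycleWalks.walksViaFrom C k v l z).ncard := by
        intro v hv z hz
        refine CycleWalks.ncard_walksVia_eq_mul C fun z' hz' => ?_
        rw [CycleWalks.ncard_walksViaFrom hs hC hik' hv hl hlk hz',
          CycleWalks.ncard_walksViaFrom hs hC hik' hv hl hlk hz]
      refine ⟨hfib _ hm₀, hfib _ hm₁, ?_, ?_⟩
      · obtain ⟨m, rfl⟩ : ∃ m, l = m + 1 := ⟨l - 1, by omega⟩
        rw [CycleWalks.ncard_initialVertices hs hC hik' hm₀ hlk, hv₀, Nat.add_sub_cancel_left,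
          CycleWalks.branchCount_eq, CycleWalks.floor_half, CycleWalks.ceil_half]
        push_cast [Nat.cast_sub hc2, Nat.cast_sub (by omega : 1 ≤ c),
          Nat.cast_sub (by omega : 1 ≤ d)]
        ring
      · obtain ⟨m, rfl⟩ : ∃ m, l = m + 1 := ⟨l - 1, by omega⟩
        rw [CycleWalks.ncard_initialVertices hs hC hik' hm₁ hlk, hv₁, Nat.add_sub_cancel,
          add_comm c d, CycleWalks.branchCount_eq, CycleWalks.floor_half, CycleWalks.ceil_half]
        push_cast [Nat.cast_sub hd2, Nat.cast_sub (by omega : 1 ≤ c),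
          Nat.cast_sub (by omega : 1 ≤ d)]
        ring
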